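/- For a code $\mathscr C\subseteq\mathbb Z^2$, let $d$ be the Euclidean ($\ell_2$) distance, $B(x,s)=\{z\in\mathbb Z^2: d(z,x)\le s\}$ and $\mathcal D=\{d(z,c): z\in\mathbb Z^2,\ c\in\mathscr C\}$. The packing radius $r$ of $\mathscr C$ is the greatest $s\in\mathcal D$ such that the balls $B(c,s)$ around distinct codewords $c\in\mathscr C$ are disjoint; the covering radius $R$ is the smallest $s\in\mathcal D$ such that the balls $B(c,s)$, $c\in\mathscr C$, cover $\mathbb Z^2$. The code is quasi-perfect if $\mathcal D\cap[r,R)$ has exactly one element. A linear code is an additive subgroup of $\mathbb Z^2$ of rank $2$; two linear codes are equivalent (congruent) if a permutation of the coordinates composed with sign changes maps one onto the other; a matrix $B$ generates the code $\{xB: x\in\mathbb Z^2\}$. Then the packing radii of the quasi-perfect linear codes in $\mathbb Z^2$ with positive packing radius are exactly $1,2,3,4,\sqrt2,\sqrt5,2\sqrt5,\sqrt{10}$. Moreover a linear code in $\mathbb Z^2$ is quasi-perfect with positive packing radius if and only if it is equivalent to the code generated by one of the matrices $\begin{pmatrix}a&b\\0&m\end{pmatrix}$ with $(a,b,m)$ in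 $$\mathcal A:\ (1,2,6),(1,2,7),(1,3,7),(1,3,8),(1,3,11),(1,4,11),(2,3,6),(1,4,14),(1,4,15),(1,6,15),(1,6,16),(1,4,17),(1,5,17),(1,7,17),(1,4,18),$$ $$(1,5,18),(1,7,18),(1,4,19),(1,5,19),(1,8,20),(1,5,23),(1,9,23),(1,5,24),(1,6,33),(1,6,34),(1,10,35),(1,7,39),(1,11,39),(1,12,42),$$ or in the further list $(1,8,53),(1,20,53),(1,9,77),(1,17,77)$. (Some of the listed codes are equivalent to each other.) -/

import Mathlib

/-- The `ℓ₂` (Euclidean) distance between two points of `ℤⁿ`. -/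
noncomputable def l2dist {n : ℕ} (x y : Fin n → ℤ) : ℝ :=
  Real.sqrt (∑ i, ((x i : ℝ) - (y i : ℝ)) ^ 2)

/-- The closed `ℓ₂` ball in `ℤⁿ` with center `x` and radius `r`. -/
def l2ball {n : ℕ} (x : Fin n → ℤ) (r : ℝ) : Set (Fin n → ℤ) :=
  {z | l2dist z x ≤ r}

/-- The distance set of a code `C ⊆ ℤⁿ`: all distances between a point of `ℤⁿ` and a codeword. -/
def distanceSet {n : ℕ} (C : Set (Fin n → ℤ)) : Set ℝ :=
  {d | ∃ z : Fin n → ℤ, ∃ c ∈ C, l2dist z c = d}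

/-- `r` is the packing radius of `C`: the greatest element of the distance set such that
the balls of radius `r` around distinct codewords are disjoint. -/
def IsPackingRadius {n : ℕ} (C : Set (Fin n → ℤ)) (r : ℝ) : Prop :=
  IsGreatest {s | s ∈ distanceSet C ∧
    ∀ x ∈ C, ∀ y ∈ C, x ≠ y → l2ball x s ∩ l2ball y s = ∅} r

/-- `R` is the covering radius of `C`: the smallest element of the distance set such that
the balls of radius `R` around the codewords cover `ℤⁿ`. -/
def IsCoveringRadius {n : ℕ} (C : Set (Fin n → ℤ)) (R : ℝ) : Prop :=
  IsLeast {s | s ∈ distanceSet C ∧ (⋃ c ∈ C, l2ball c s) = Set.univ} R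

/-- `C` is `t`-imperfect: its packing radius `r` and covering radius `R` exist, and the
distance set has exactly `t` elements in `[r, R)`. -/
def IsImperfect {n : ℕ} (C : Set (Fin n → ℤ)) (t : ℕ) : Prop :=
  ∃ r R : ℝ, IsPackingRadius C r ∧ IsCoveringRadius C R ∧
    (distanceSet C ∩ Set.Ico r R).encard = t

/-- A quasi-perfect code is a `1`-imperfect code. -/
def IsQuasiPerfect {n : ℕ} (C : Set (Fin n → ℤ)) : Prop :=
  IsImperfect C 1

/-- A linear code in `ℤⁿ` is an additive subgroup of full rank. -/
def IsLinearCode {n : ℕ} (L : AddSubgroup (Fin n → ℤ)) : Prop :=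
  Module.finrank ℤ L = n

/-- The lattice `{x B : x ∈ ℤⁿ}` with generator matrix `B` (the rows of `B` generate it). -/
def latticeOf {n : ℕ} (B : Matrix (Fin n) (Fin n) ℤ) : AddSubgroup (Fin n → ℤ) :=
  B.vecMulLinear.toAddMonoidHom.range

/-- Two lattices in `ℤⁿ` are congruent when a permutation of the coordinates composed with
sign changes takes one onto the other. -/
def LatticeCongruent {n : ℕ} (L₁ L₂ : AddSubgroup (Fin n → ℤ)) : Prop :=
  ∃ (σ : Equiv.Perm (Fin n)) (ε : Fin n → ℤˣ),
    ∀ v : Fin n → ℤ, v ∈ L₁ ↔ (fun i => (ε i : ℤ) * v (σ i)) ∈ L₂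

/-- The set `𝒜` of generator matrices. -/
def generatorsA : Finset (Matrix (Fin 2) (Fin 2) ℤ) :=
  {!![1, 2; 0, 6], !![1, 2; 0, 7], !![1, 3; 0, 7], !![1, 3; 0, 8], !![1, 3; 0, 11],
   !![1, 4; 0, 11], !![2, 3; 0, 6], !![1, 4; 0, 14], !![1, 4; 0, 15], !![1, 6; 0, 15],
   !![1, 6; 0, 16], !![1, 4; 0, 17], !![1, 5; 0, 17], !![1, 7; 0, 17], !![1, 4; 0, 18],
   !![1, 5; 0, 18], !![1, 7; 0, 18], !![1, 4; 0, 19], !![1, 5; 0, 19], !![1, 8; 0, 20],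
   !![1, 5; 0, 23], !![1, 9; 0, 23], !![1, 5; 0, 24], !![1, 6; 0, 33], !![1, 6; 0, 34],
   !![1, 10; 0, 35], !![1, 7; 0, 39], !![1, 11; 0, 39], !![1, 12; 0, 42]}

/-- The four further generator matrices, of determinants 53 and 77. -/
def generatorsExtra : Finset (Matrix (Fin 2) (Fin 2) ℤ) :=
  {!![1, 8; 0, 53], !![1, 20; 0, 53], !![1, 9; 0, 77], !![1, 17; 0, 77]}

/-! Every distance in question is the root of a sum of two squares, and the distance set is the same
for all lattices. So quasi-perfection says that the squared covering radius `t` is the next sum of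
two squares after the squared packing radius `s` (`QuasiPerfectAt`). Everything is then a statement
about integers.

Upper bound on `t`: a nonzero lattice vector is the difference of two nearly equal halves, so
packing fails at the sum of two squares `splitNorm` of that vector. This value exceeds `s`, hence is
at least `t` (`QuasiPerfectAt.le_splitNorm`). For the shortest vector `u` it is about `|u|² / 4`.

Lower bound on covering: take a Gauss-reduced basis `u, v`. The circumcenter of the triangle `0, u,
v` has no lattice point closer than the vertices. Rounding it to an integer point costs at most 1/2
per coordinate, so the circumradius cannot much exceed the covering radius
(`ReducedBasis.circumradius_le`). The squared circumradius is at least `|u|² / 3`, while the first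
bound is `|u|² / 4` plus a linear term, so `u` is bounded. Then `v` is bounded as well
(`ReducedBasis.bounds`).

Up to signed permutation finitely many reduced pairs remain, and the kernel evaluates all of them
(`pairTest_eq_true`). Each pair violates a necessary inequality, has an explicit uncovered point,
spans a perfect lattice (never quasi-perfect), or spans a listed lattice. The listed lattices are
checked directly, and their values of `s` give the radii. -/

/-- Packing at squared radius `s`, for a set `M` of points of `ℤ²`. -/
def Packs (M : ℤ → ℤ → Prop) (s : ℤ) : Prop :=
  ∀ a b c d : ℤ, a ^ 2 + b ^ 2 ≤ s → c ^ 2 + d ^ 2 ≤ s → M (a - c) (b - d) → a = c ∧ b = d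

/-- Covering at squared radius `s`, for a set `M` of points of `ℤ²`. -/
def Covers (M : ℤ → ℤ → Prop) (s : ℤ) : Prop :=
  ∀ x y : ℤ, ∃ a b : ℤ, a ^ 2 + b ^ 2 ≤ s ∧ M (x - a) (y - b)

/-- Sums of two integer squares. -/
def SumSq (k : ℤ) : Prop := ∃ a b : ℤ, a ^ 2 + b ^ 2 = k

theorem SumSq.nonneg {k : ℤ} (h : SumSq k) : 0 ≤ k := by
  obtain ⟨a, b, rfl⟩ := h
  positivity

/-- `M` is quasi-perfect with squared packing radius `s` and squared covering radius `t`. -/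
structure QuasiPerfectAt (M : ℤ → ℤ → Prop) (s t : ℤ) : Prop where
  one_le : 1 ≤ s
  lt : s < t
  sumSq_left : SumSq s
  sumSq_right : SumSq t
  gap : ∀ k, SumSq k → s < k → t ≤ k
  packs : Packs M s
  not_packs : ¬ Packs M t
  covers : Covers M t
  not_covers : ¬ Covers M s

theorem Packs.mono {M : ℤ → ℤ → Prop} {s t : ℤ} (h : Packs M t) (hst : s ≤ t) : Packs M s :=
  fun a b c d h1 h2 h3 => h a b c d (h1.trans hst) (h2.trans hst) h3

theorem Covers.mono {M : ℤ → ℤ → Prop} {s t : ℤ} (h : Covers M s) (hst : s ≤ t) : Covers M t := by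
  intro x y
  obtain ⟨a, b, h1, h2⟩ := h x y
  exact ⟨a, b, h1.trans hst, h2⟩

/-! ### Radii expressed through squared integer norms -/

/-- The membership predicate of a subgroup of `ℤ²` in coordinates. -/
def memPred (L : AddSubgroup (Fin 2 → ℤ)) (x y : ℤ) : Prop := ![x, y] ∈ L

theorem mem_iff_memPred (L : AddSubgroup (Fin 2 → ℤ)) (v : Fin 2 → ℤ) :
    v ∈ L ↔ memPred L (v 0) (v 1) := by
  unfold memPred
  rw [show ![v 0, v 1] = v from by ext i; fin_cases i <;> rfl]

theorem l2dist_eq (x y : Fin 2 → ℤ) :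
    l2dist x y = √(((x 0 - y 0) ^ 2 + (x 1 - y 1) ^ 2 : ℤ) : ℝ) := by
  simp [l2dist, Fin.sum_univ_two]

theorem l2dist_le_sqrt_iff (x y : Fin 2 → ℤ) (k : ℤ) (hk : 0 ≤ k) :
    l2dist x y ≤ √(k : ℝ) ↔ (x 0 - y 0) ^ 2 + (x 1 - y 1) ^ 2 ≤ k := by
  rw [l2dist_eq, Real.sqrt_le_sqrt_iff (by exact_mod_cast hk)]
  exact_mod_cast Iff.rfl

theorem sqrt_intCast_lt_iff {k l : ℤ} (hk : 0 ≤ k) : √(k : ℝ) < √(l : ℝ) ↔ k < l := by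
  rw [Real.sqrt_lt_sqrt_iff (by exact_mod_cast hk)]
  exact_mod_cast Iff.rfl

theorem sqrt_intCast_le_iff {k l : ℤ} (hl : 0 ≤ l) : √(k : ℝ) ≤ √(l : ℝ) ↔ k ≤ l := by
  rw [Real.sqrt_le_sqrt_iff (by exact_mod_cast hl)]
  exact_mod_cast Iff.rfl

/-- Since `0 ∈ L`, every norm of an integer point already occurs, so the distance set does not
depend on `L`. -/
theorem mem_distanceSet_iff (L : AddSubgroup (Fin 2 → ℤ)) (d : ℝ) :
    d ∈ distanceSet (L : Set (Fin 2 → ℤ)) ↔ ∃ k : ℤ, SumSq k ∧ √(k : ℝ) = d := by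
  constructor
  · rintro ⟨z, c, -, rfl⟩
    exact ⟨_, ⟨_, _, rfl⟩, (l2dist_eq z c).symm⟩
  · rintro ⟨k, ⟨a, b, rfl⟩, rfl⟩
    exact ⟨![a, b], 0, L.zero_mem, by rw [l2dist_eq]; simp⟩

theorem balls_disjoint_iff (L : AddSubgroup (Fin 2 → ℤ)) {k : ℤ} (hk : 0 ≤ k) :
    (∀ x ∈ (L : Set (Fin 2 → ℤ)), ∀ y ∈ (L : Set (Fin 2 → ℤ)), x ≠ y →
      l2ball x √(k : ℝ) ∩ l2ball y √(k : ℝ) = ∅) ↔ Packs (memPred L) k := by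
  constructor
  · intro h a b c d hab hcd hM
    by_contra hne
    have h0 : ![a - c, b - d] ≠ 0 := by
      intro h0
      have h1 := congrFun h0 0
      have h2 := congrFun h0 1
      simp at h1 h2
      omega
    have h3 := h _ hM 0 L.zero_mem h0
    have h4 : (![a, b] : Fin 2 → ℤ) ∈ (∅ : Set (Fin 2 → ℤ)) := by
      rw [← h3]
      constructor
      · change l2dist _ _ ≤ _
        rw [l2dist_le_sqrt_iff _ _ _ hk]
        simpa using hcd
      · change l2dist _ _ ≤ _
        rw [l2dist_le_sqrt_iff _ _ _ hk]
        simpa using hab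
    exact h4
  · intro h x hx y hy hxy
    rw [Set.eq_empty_iff_forall_notMem]
    rintro z ⟨hzx, hzy⟩
    change l2dist _ _ ≤ _ at hzx hzy
    rw [l2dist_le_sqrt_iff _ _ _ hk] at hzx hzy
    have h1 : memPred L ((z 0 - x 0) - (z 0 - y 0)) ((z 1 - x 1) - (z 1 - y 1)) := by
      have h2 := (mem_iff_memPred L _).1 (L.sub_mem hy hx)
      convert h2 using 1 <;> simp
    have h2 := h _ _ _ _ hzx hzy h1
    apply hxy
    ext i
    fin_cases i
    · have := h2.1
      simp only [Fin.zero_eta]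
      omega
    · have := h2.2
      simp only [Fin.mk_one]
      omega

theorem balls_cover_iff (L : AddSubgroup (Fin 2 → ℤ)) {k : ℤ} (hk : 0 ≤ k) :
    (⋃ c ∈ (L : Set (Fin 2 → ℤ)), l2ball c √(k : ℝ)) = Set.univ ↔ Covers (memPred L) k := by
  rw [Set.eq_univ_iff_forall]
  constructor
  · intro h x y
    obtain ⟨c, hc, hz⟩ := Set.mem_iUnion₂.1 (h ![x, y])
    change l2dist _ _ ≤ _ at hz
    rw [l2dist_le_sqrt_iff _ _ _ hk] at hz
    refine ⟨x - c 0, y - c 1, by simpa using hz, ?_⟩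
    simpa using (mem_iff_memPred L c).1 hc
  · intro h z
    obtain ⟨a, b, hab, hM⟩ := h (z 0) (z 1)
    refine Set.mem_iUnion₂.2 ⟨_, hM, ?_⟩
    change l2dist _ _ ≤ _
    rw [l2dist_le_sqrt_iff _ _ _ hk]
    simpa using hab

theorem isPackingRadius_iff (L : AddSubgroup (Fin 2 → ℤ)) (r : ℝ) :
    IsPackingRadius (L : Set (Fin 2 → ℤ)) r ↔ ∃ s : ℤ, SumSq s ∧ √(s : ℝ) = r ∧
      Packs (memPred L) s ∧ ∀ k, SumSq k → Packs (memPred L) k → k ≤ s := by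
  constructor
  · rintro ⟨⟨hr, hd⟩, hub⟩
    obtain ⟨s, hs, rfl⟩ := (mem_distanceSet_iff L r).1 hr
    refine ⟨s, hs, rfl, (balls_disjoint_iff L hs.nonneg).1 hd, fun k hk hP => ?_⟩
    have := hub ⟨(mem_distanceSet_iff L _).2 ⟨k, hk, rfl⟩, (balls_disjoint_iff L hk.nonneg).2 hP⟩
    exact (sqrt_intCast_le_iff hs.nonneg).1 this
  · rintro ⟨s, hs, rfl, hP, hmax⟩
    refine ⟨⟨(mem_distanceSet_iff L _).2 ⟨s, hs, rfl⟩, (balls_disjoint_iff L hs.nonneg).2 hP⟩, ?_⟩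
    rintro d ⟨hd, hdis⟩
    obtain ⟨k, hk, rfl⟩ := (mem_distanceSet_iff L d).1 hd
    exact (sqrt_intCast_le_iff hs.nonneg).2 (hmax k hk ((balls_disjoint_iff L hk.nonneg).1 hdis))

theorem isCoveringRadius_iff (L : AddSubgroup (Fin 2 → ℤ)) (R : ℝ) :
    IsCoveringRadius (L : Set (Fin 2 → ℤ)) R ↔ ∃ t : ℤ, SumSq t ∧ √(t : ℝ) = R ∧
      Covers (memPred L) t ∧ ∀ k, SumSq k → Covers (memPred L) k → t ≤ k := by
  constructor
  · rintro ⟨⟨hr, hd⟩, hlb⟩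
    obtain ⟨s, hs, rfl⟩ := (mem_distanceSet_iff L R).1 hr
    refine ⟨s, hs, rfl, (balls_cover_iff L hs.nonneg).1 hd, fun k hk hP => ?_⟩
    have := hlb ⟨(mem_distanceSet_iff L _).2 ⟨k, hk, rfl⟩, (balls_cover_iff L hk.nonneg).2 hP⟩
    exact (sqrt_intCast_le_iff hk.nonneg).1 this
  · rintro ⟨s, hs, rfl, hP, hmin⟩
    refine ⟨⟨(mem_distanceSet_iff L _).2 ⟨s, hs, rfl⟩, (balls_cover_iff L hs.nonneg).2 hP⟩, ?_⟩
    rintro d ⟨hd, hdis⟩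
    obtain ⟨k, hk, rfl⟩ := (mem_distanceSet_iff L d).1 hd
    exact (sqrt_intCast_le_iff hk.nonneg).2 (hmin k hk ((balls_cover_iff L hk.nonneg).1 hdis))

/-- The only distance in `[r, R)` must be `r` itself, so no sum of two squares lies strictly between
`s` and `t`. Maximality of `s` and minimality of `t` give the two failures. -/
theorem quasiPerfectAt_of_isQuasiPerfect {L : AddSubgroup (Fin 2 → ℤ)}
    (hL : IsQuasiPerfect (L : Set (Fin 2 → ℤ))) {r : ℝ} (hr : 0 < r)
    (hp : IsPackingRadius (L : Set (Fin 2 → ℤ)) r) :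
    ∃ s t : ℤ, √(s : ℝ) = r ∧ QuasiPerfectAt (memPred L) s t := by
  obtain ⟨r', R, hp', hR, hcard⟩ := hL
  obtain rfl : r = r' := hp.unique hp'
  obtain ⟨s, hs, rfl, hP, hmax⟩ := (isPackingRadius_iff L r).1 hp
  obtain ⟨t, ht, rfl, hC, hmin⟩ := (isCoveringRadius_iff L R).1 hR
  obtain ⟨x, hx⟩ := Set.encard_eq_one.1 (by exact_mod_cast hcard)
  have hxm : x ∈ distanceSet (L : Set (Fin 2 → ℤ)) ∩ Set.Ico √(s : ℝ) √(t : ℝ) := by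
    rw [hx]; rfl
  have hlt : √(s : ℝ) < √(t : ℝ) := hxm.2.1.trans_lt hxm.2.2
  have key : ∀ k, SumSq k → s ≤ k → k < t → √(k : ℝ) = x := by
    intro k hk h1 h2
    have : √(k : ℝ) ∈ distanceSet (L : Set (Fin 2 → ℤ)) ∩ Set.Ico √(s : ℝ) √(t : ℝ) :=
      ⟨(mem_distanceSet_iff L _).2 ⟨k, hk, rfl⟩, (sqrt_intCast_le_iff hk.nonneg).2 h1,
        (sqrt_intCast_lt_iff hk.nonneg).2 h2⟩
    rw [hx] at this
    exact this
  have hst : s < t := (sqrt_intCast_lt_iff hs.nonneg).1 hlt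
  refine ⟨s, t, rfl, ?_, hst, hs, ht, ?_, hP, ?_, hC, ?_⟩
  · have : (0 : ℝ) < (s : ℝ) := Real.sqrt_pos.1 hr
    exact_mod_cast this
  · intro k hk hsk
    by_contra! hkt
    have h1 := key k hk hsk.le hkt
    have h2 := key s hs le_rfl hst
    have h3 := (sqrt_intCast_lt_iff hs.nonneg).2 hsk
    rw [h1, h2] at h3
    exact lt_irrefl _ h3
  · intro h
    exact absurd (hmax t ht h) (not_le.2 hst)
  · intro h
    exact absurd (hmin s hs h) (not_le.2 hst)

namespace QuasiPerfectAt

variable {L : AddSubgroup (Fin 2 → ℤ)} {s t : ℤ}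

theorem isPackingRadius (h : QuasiPerfectAt (memPred L) s t) :
    IsPackingRadius (L : Set (Fin 2 → ℤ)) √(s : ℝ) := by
  refine (isPackingRadius_iff L _).2 ⟨s, h.sumSq_left, rfl, h.packs, fun k hk hP => ?_⟩
  by_contra! hlt
  exact h.not_packs (hP.mono (h.gap k hk hlt))

theorem isQuasiPerfect (h : QuasiPerfectAt (memPred L) s t) :
    IsQuasiPerfect (L : Set (Fin 2 → ℤ)) := by
  refine ⟨√(s : ℝ), √(t : ℝ), h.isPackingRadius, (isCoveringRadius_iff L _).2
    ⟨t, h.sumSq_right, rfl, h.covers, fun k hk hC => ?_⟩, ?_⟩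
  · refine h.gap k hk ?_
    by_contra! hle
    exact h.not_covers (hC.mono hle)
  · have : distanceSet (L : Set (Fin 2 → ℤ)) ∩ Set.Ico √(s : ℝ) √(t : ℝ) = {√(s : ℝ)} := by
      ext d
      constructor
      · rintro ⟨hd, hd1, hd2⟩
        obtain ⟨k, hk, rfl⟩ := (mem_distanceSet_iff L d).1 hd
        have h1 := (sqrt_intCast_le_iff hk.nonneg).1 hd1
        have h2 := (sqrt_intCast_lt_iff hk.nonneg).1 hd2
        rcases h1.eq_or_lt with rfl | h3
        · rfl
        · exact absurd (h.gap k hk h3) (not_le.2 h2)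
      · rintro rfl
        exact ⟨(mem_distanceSet_iff L _).2 ⟨s, h.sumSq_left, rfl⟩, le_rfl,
          (sqrt_intCast_lt_iff h.sumSq_left.nonneg).2 h.lt⟩
    rw [this, Set.encard_singleton]
    rfl

theorem sqrt_pos {M : ℤ → ℤ → Prop} (h : QuasiPerfectAt M s t) : 0 < √(s : ℝ) :=
  Real.sqrt_pos.2 (by exact_mod_cast h.one_le)

end QuasiPerfectAt

/-! ### Invariance under signed permutations -/

/-- The preimage of `M` under a signed permutation of the two coordinates. -/
def signedPerm (e f : ℤˣ) (sw : Bool) (M : ℤ → ℤ → Prop) (x y : ℤ) : Prop :=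
  if sw then M (e * y) (f * x) else M (e * x) (f * y)

/-- Congruence of subsets of `ℤ²`. -/
def SignedCongruent (M N : ℤ → ℤ → Prop) : Prop :=
  ∃ (e f : ℤˣ) (sw : Bool), ∀ x y, M x y ↔ signedPerm e f sw N x y

theorem Int.units_coe_mul_coe_self (e : ℤˣ) : (e : ℤ) * e = 1 := by
  rcases Int.units_eq_one_or e with rfl | rfl <;> simp

theorem Int.units_coe_mul_coe_mul (e : ℤˣ) (x : ℤ) : (e : ℤ) * (e * x) = x := by
  rw [← mul_assoc, Int.units_coe_mul_coe_self, one_mul]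

theorem Int.units_mul_sq (e : ℤˣ) (x : ℤ) : ((e : ℤ) * x) ^ 2 = x ^ 2 := by
  rcases Int.units_eq_one_or e with rfl | rfl <;> simp

theorem SignedCongruent.symm {M N : ℤ → ℤ → Prop} (h : SignedCongruent M N) : SignedCongruent N M := by
  obtain ⟨e, f, sw, h⟩ := h
  cases sw
  · refine ⟨e, f, false, fun x y => ?_⟩
    simp only [signedPerm, Bool.false_eq_true, if_false] at h ⊢
    rw [h, Int.units_coe_mul_coe_mul, Int.units_coe_mul_coe_mul]
  · refine ⟨f, e, true, fun x y => ?_⟩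
    simp only [signedPerm, if_true] at h ⊢
    rw [h, Int.units_coe_mul_coe_mul, Int.units_coe_mul_coe_mul]

theorem SignedCongruent.trans {M N P : ℤ → ℤ → Prop} (h : SignedCongruent M N) (h' : SignedCongruent N P) :
    SignedCongruent M P := by
  obtain ⟨e, f, sw, h⟩ := h
  obtain ⟨e', f', sw', h'⟩ := h'
  cases sw <;> cases sw' <;>
    simp only [signedPerm, Bool.false_eq_true, if_false, if_true] at h h'
  · refine ⟨e' * e, f' * f, false, fun x y => ?_⟩
    simp [signedPerm, h, h', mul_assoc]
  · refine ⟨e' * f, f' * e, true, fun x y => ?_⟩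
    simp [signedPerm, h, h', mul_assoc]
  · refine ⟨e' * e, f' * f, true, fun x y => ?_⟩
    simp [signedPerm, h, h', mul_assoc]
  · refine ⟨e' * f, f' * e, false, fun x y => ?_⟩
    simp [signedPerm, h, h', mul_assoc]

theorem SignedCongruent.covers {M N : ℤ → ℤ → Prop} (h : SignedCongruent M N) {s : ℤ} (hN : Covers N s) :
    Covers M s := by
  obtain ⟨e, f, sw, h⟩ := h
  intro x y
  cases sw <;> simp only [signedPerm, Bool.false_eq_true, if_false, if_true] at h
  · obtain ⟨a, b, hab, hm⟩ := hN (e * x) (f * y)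
    refine ⟨e * a, f * b, by simpa only [Int.units_mul_sq] using hab, ?_⟩
    rw [h, mul_sub, mul_sub, Int.units_coe_mul_coe_mul, Int.units_coe_mul_coe_mul]
    exact hm
  · obtain ⟨a, b, hab, hm⟩ := hN (e * y) (f * x)
    refine ⟨f * b, e * a, by simpa only [Int.units_mul_sq, add_comm] using hab, ?_⟩
    rw [h, mul_sub, mul_sub, Int.units_coe_mul_coe_mul, Int.units_coe_mul_coe_mul]
    exact hm

theorem SignedCongruent.packs {M N : ℤ → ℤ → Prop} (h : SignedCongruent M N) {s : ℤ} (hN : Packs N s) :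
    Packs M s := by
  obtain ⟨e, f, sw, h⟩ := h
  intro a b c d hab hcd hm
  cases sw <;> simp only [signedPerm, Bool.false_eq_true, if_false, if_true] at h
  · have := hN (e * a) (f * b) (e * c) (f * d) (by simpa only [Int.units_mul_sq] using hab)
      (by simpa only [Int.units_mul_sq] using hcd) (by rw [← mul_sub, ← mul_sub]; exact (h _ _).1 hm)
    simpa using this
  · have := hN (e * b) (f * a) (e * d) (f * c)
      (by simpa only [Int.units_mul_sq, add_comm] using hab)
      (by simpa only [Int.units_mul_sq, add_comm] using hcd)
      (by rw [← mul_sub, ← mul_sub]; exact (h _ _).1 hm)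
    simpa [and_comm] using this

theorem SignedCongruent.quasiPerfectAt {M N : ℤ → ℤ → Prop} (h : SignedCongruent M N) {s t : ℤ}
    (hN : QuasiPerfectAt N s t) : QuasiPerfectAt M s t :=
  ⟨hN.one_le, hN.lt, hN.sumSq_left, hN.sumSq_right, hN.gap, h.packs hN.packs,
    fun hM => hN.not_packs (h.symm.packs hM), h.covers hN.covers,
    fun hM => hN.not_covers (h.symm.covers hM)⟩

theorem latticeCongruent_iff (L₁ L₂ : AddSubgroup (Fin 2 → ℤ)) :
    LatticeCongruent L₁ L₂ ↔ SignedCongruent (memPred L₁) (memPred L₂) := by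
  constructor
  · rintro ⟨σ, ε, h⟩
    have hσ : σ = 1 ∨ σ = Equiv.swap 0 1 := by
      clear h
      revert σ
      decide
    rcases hσ with rfl | rfl
    · refine ⟨ε 0, ε 1, false, fun x y => ?_⟩
      have := h ![x, y]
      rw [mem_iff_memPred, mem_iff_memPred L₂] at this
      simpa [signedPerm] using this
    · refine ⟨ε 0, ε 1, true, fun x y => ?_⟩
      have := h ![x, y]
      rw [mem_iff_memPred, mem_iff_memPred L₂] at this
      simpa [signedPerm] using this
  · rintro ⟨e, f, sw, h⟩
    cases sw
    · refine ⟨1, ![e, f], fun v => ?_⟩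
      rw [mem_iff_memPred, mem_iff_memPred L₂, h]
      simp [signedPerm]
    · refine ⟨Equiv.swap 0 1, ![e, f], fun v => ?_⟩
      rw [mem_iff_memPred, mem_iff_memPred L₂, h]
      simp [signedPerm]

/-! ### Full rank in terms of a determinant -/

/-- `M` contains two linearly independent vectors. -/
def HasRankTwo (M : ℤ → ℤ → Prop) : Prop :=
  ∃ a b c d : ℤ, M a b ∧ M c d ∧ a * d - b * c ≠ 0

theorem SignedCongruent.hasRankTwo {M N : ℤ → ℤ → Prop} (h : SignedCongruent M N) (hN : HasRankTwo N) :
    HasRankTwo M := by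
  obtain ⟨e, f, sw, h⟩ := h.symm
  obtain ⟨a, b, c, d, h1, h2, h3⟩ := hN
  rw [h] at h1 h2
  have he : (e : ℤ) ≠ 0 := e.ne_zero
  have hf : (f : ℤ) ≠ 0 := f.ne_zero
  cases sw <;> simp only [signedPerm, Bool.false_eq_true, if_false, if_true] at h1 h2
  · refine ⟨_, _, _, _, h1, h2, ?_⟩
    have : (e : ℤ) * a * (f * d) - f * b * (e * c) = e * f * (a * d - b * c) := by ring
    rw [this]
    exact mul_ne_zero (mul_ne_zero he hf) h3
  · refine ⟨_, _, _, _, h1, h2, ?_⟩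
    have : (e : ℤ) * b * (f * c) - f * a * (e * d) = -(e * f * (a * d - b * c)) := by ring
    rw [this]
    exact neg_ne_zero.2 (mul_ne_zero (mul_ne_zero he hf) h3)

theorem isLinearCode_iff (L : AddSubgroup (Fin 2 → ℤ)) :
    IsLinearCode L ↔ HasRankTwo (memPred L) := by
  have hle : Module.finrank ℤ L ≤ 2 := by
    have h := Submodule.finrank_le (AddSubgroup.toIntSubmodule L)
    rw [Module.finrank_fin_fun] at h
    exact h
  constructor
  · intro h
    have h : Module.finrank ℤ (AddSubgroup.toIntSubmodule L) = 2 := h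
    let B := Module.finBasisOfFinrankEq ℤ (AddSubgroup.toIntSubmodule L) h
    have hli : LinearIndependent ℤ (fun i => (B i : Fin 2 → ℤ)) :=
      B.linearIndependent.map' (AddSubgroup.toIntSubmodule L).subtype
        (Submodule.ker_subtype _)
    refine ⟨(B 0 : Fin 2 → ℤ) 0, (B 0 : Fin 2 → ℤ) 1, (B 1 : Fin 2 → ℤ) 0, (B 1 : Fin 2 → ℤ) 1,
      (mem_iff_memPred L _).1 (B 0).2, (mem_iff_memPred L _).1 (B 1).2, fun h0 => ?_⟩
    have hz := LinearIndependent.pair_iff.1 (show LinearIndependent ℤ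
      ![(B 0 : Fin 2 → ℤ), (B 1 : Fin 2 → ℤ)] by
        convert hli using 1
        ext i j
        fin_cases i <;> rfl)
    -- With zero determinant, cross-multiplying by either coordinate gives an integer relation
    -- between the basis vectors. The two relations force both coordinates of the second vector to
    -- vanish.
    have hx := hz ((B 1 : Fin 2 → ℤ) 0) (-(B 0 : Fin 2 → ℤ) 0) (by
      ext i
      fin_cases i
      · simp; ring
      · simp; linarith)
    have hy := hz ((B 1 : Fin 2 → ℤ) 1) (-(B 0 : Fin 2 → ℤ) 1) (by
      ext i
      fin_cases i
      · simp; linarith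
      · simp; ring)
    have hb : (B 1 : Fin 2 → ℤ) = 0 := by
      ext i
      fin_cases i
      · exact hx.1
      · exact hy.1
    exact hli.ne_zero 1 hb
  · rintro ⟨a, b, c, d, h1, h2, h3⟩
    refine le_antisymm hle ?_
    have hli : LinearIndependent ℤ ![(⟨_, h1⟩ : L), ⟨_, h2⟩] := by
      rw [LinearIndependent.pair_iff]
      intro s t hst
      have h4 := congrArg Subtype.val hst
      have h5 := congrFun h4 0
      have h6 := congrFun h4 1
      simp at h5 h6
      constructor
      · apply (mul_eq_zero.1 (show s * (a * d - b * c) = 0 by linear_combination d * h5 - c * h6)).resolve_right h3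
      · apply (mul_eq_zero.1 (show t * (a * d - b * c) = 0 by linear_combination a * h6 - b * h5)).resolve_right h3
    have : Module.Finite ℤ L :=
      inferInstanceAs (Module.Finite ℤ (AddSubgroup.toIntSubmodule L))
    have := hli.fintype_card_le_finrank
    simpa using this

/-! ### Kernel-computable tests for packing and covering -/

/-- `p k` holds for all `k < n`. -/
def allBelow (p : ℕ → Bool) : ℕ → Bool
  | 0 => true
  | n + 1 => p n && allBelow p n

theorem allBelow_eq_true_iff (p : ℕ → Bool) (n : ℕ) :
    allBelow p n = true ↔ ∀ k < n, p k = true := by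
  induction n with
  | zero => simp [allBelow]
  | succ n ih =>
    rw [allBelow, Bool.and_eq_true, ih]
    exact ⟨fun h k hk => (Nat.lt_succ_iff_lt_or_eq.1 hk).elim (h.2 k) fun h' => h' ▸ h.1,
      fun h => ⟨h n n.lt_succ_self, fun k hk => h k (hk.trans n.lt_succ_self)⟩⟩

/-- `f x`, with `x` evaluated to a literal first when the kernel computes. -/
def evalAt (x : ℤ) (f : ℤ → Bool) : Bool :=
  match x with
  | Int.ofNat 0 => f 0
  | Int.ofNat (n + 1) => f (Int.ofNat (n + 1))
  | Int.negSucc 0 => f (-1)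
  | Int.negSucc (n + 1) => f (Int.negSucc (n + 1))

theorem evalAt_eq (x : ℤ) (f : ℤ → Bool) : evalAt x f = f x := by
  unfold evalAt
  split <;> rfl

/-- `p k` holds for all integers `k` in `[lo, hi]`. -/
def allIcc (lo hi : ℤ) (p : ℤ → Bool) : Bool :=
  allBelow (fun k => evalAt (lo + k) p) (hi + 1 - lo).toNat

/-- `p k` holds for some integer `k` in `[lo, hi]`. -/
def anyIcc (lo hi : ℤ) (p : ℤ → Bool) : Bool := !allIcc lo hi fun k => !p k

theorem allIcc_eq_true_iff (lo hi : ℤ) (p : ℤ → Bool) :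
    allIcc lo hi p = true ↔ ∀ k, lo ≤ k → k ≤ hi → p k = true := by
  simp only [allIcc, allBelow_eq_true_iff, evalAt_eq]
  constructor
  · intro h k h1 h2
    have := h (k - lo).toNat (by omega)
    rwa [show lo + ((k - lo).toNat : ℤ) = k by omega] at this
  · intro h k hk
    exact h _ (by omega) (by omega)

theorem anyIcc_eq_true_iff (lo hi : ℤ) (p : ℤ → Bool) :
    anyIcc lo hi p = true ↔ ∃ k, lo ≤ k ∧ k ≤ hi ∧ p k = true := by
  rw [anyIcc, Bool.not_eq_true', ← Bool.not_eq_true, allIcc_eq_true_iff]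
  simp

/-- The lattice generated by `(A, b)` and `(0, m)`. -/
def hnfLattice (A b m x y : ℤ) : Prop := ∃ i j : ℤ, x = i * A ∧ y = i * b + j * m

/-- Boolean membership test for `hnfLattice`. -/
def hnfMem (A b m x y : ℤ) : Bool := x % A == 0 && (y - x / A * b) % m == 0

theorem hnfMem_eq_true_iff {A : ℤ} (hA : 0 < A) (b m x y : ℤ) :
    hnfMem A b m x y = true ↔ hnfLattice A b m x y := by
  simp only [hnfMem, hnfLattice, Bool.and_eq_true, beq_iff_eq]
  constructor
  · rintro ⟨h1, h2⟩
    obtain ⟨j, hj⟩ := Int.dvd_of_emod_eq_zero h2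
    exact ⟨x / A, j, (Int.ediv_mul_cancel (Int.dvd_of_emod_eq_zero h1)).symm,
      by linear_combination hj⟩
  · rintro ⟨i, j, rfl, rfl⟩
    rw [Int.mul_ediv_cancel _ hA.ne']
    refine ⟨by simp, ?_⟩
    rw [add_sub_cancel_left]
    simp

theorem hnfLattice_add {A b m x y x' y' : ℤ} (h : hnfLattice A b m x y)
    (h' : hnfLattice A b m x' y') : hnfLattice A b m (x + x') (y + y') := by
  obtain ⟨i, j, rfl, rfl⟩ := h
  obtain ⟨k, l, rfl, rfl⟩ := h'
  exact ⟨i + k, j + l, by ring, by ring⟩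

theorem memPred_latticeOf (A b m : ℤ) (x y : ℤ) :
    memPred (latticeOf !![A, b; 0, m]) x y ↔ hnfLattice A b m x y := by
  unfold memPred latticeOf hnfLattice
  constructor
  · rintro ⟨v, hv⟩
    have h0 := congrFun hv 0
    have h1 := congrFun hv 1
    simp [Matrix.vecMul, dotProduct, Fin.sum_univ_two] at h0 h1
    exact ⟨v 0, v 1, h0.symm, h1.symm⟩
  · rintro ⟨i, j, rfl, rfl⟩
    refine ⟨![i, j], ?_⟩
    ext k
    fin_cases k <;> simp [Matrix.vecMul, dotProduct, Fin.sum_univ_two]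

theorem abs_le_of_sq_add_sq_le {a b s k : ℤ} (h : a ^ 2 + b ^ 2 ≤ s) (hk : s < (k + 1) ^ 2)
    (hk0 : 0 ≤ k) : (-k ≤ a ∧ a ≤ k) ∧ (-k ≤ b ∧ b ≤ k) := by
  refine ⟨⟨?_, ?_⟩, ?_, ?_⟩ <;> nlinarith [sq_nonneg a, sq_nonneg b]

/-- Boolean test for the packing property, where `s < (k + 1) ^ 2`. -/
def packsTest (A b m k s : ℤ) : Bool :=
  allIcc (-(2 * k)) (2 * k) fun x => allIcc (-(2 * k)) (2 * k) fun y =>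
    !hnfMem A b m x y || (x == 0 && y == 0) ||
      allIcc (-k) k fun c => allIcc (-k) k fun d =>
        decide (s < c * c + d * d) || decide (s < (c + x) * (c + x) + (d + y) * (d + y))

/-- Boolean test for the covering property, where `s < (k + 1) ^ 2`. -/
def coversTest (A b m k s : ℤ) : Bool :=
  allIcc 0 (A - 1) fun x => allIcc 0 (m - 1) fun y =>
    anyIcc (-k) k fun c => anyIcc (-k) k fun d =>
      decide (c * c + d * d ≤ s) && hnfMem A b m (x - c) (y - d)

/-- Points of squared norm at most `s < (k + 1) ^ 2` have coordinates in `[-k, k]`, hence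
differences in `[-2k, 2k]`, so a finite search decides packing. -/
theorem packsTest_eq_true_iff {A b m k s : ℤ} (hA : 0 < A) (hk0 : 0 ≤ k) (hk : s < (k + 1) ^ 2) :
    packsTest A b m k s = true ↔ Packs (hnfLattice A b m) s := by
  simp only [packsTest, allIcc_eq_true_iff, Bool.or_eq_true, Bool.not_eq_true', Bool.and_eq_true,
    beq_iff_eq, decide_eq_true_eq, ← Bool.not_eq_true, hnfMem_eq_true_iff hA]
  constructor
  · intro h a a' c d h1 h2 hM
    obtain ⟨⟨h3, h4⟩, h5, h6⟩ := abs_le_of_sq_add_sq_le h1 hk hk0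
    obtain ⟨⟨h7, h8⟩, h9, h10⟩ := abs_le_of_sq_add_sq_le h2 hk hk0
    rcases h (a - c) (by omega) (by omega) (a' - d) (by omega) (by omega) with (h11 | h11) | h11
    · exact absurd hM h11
    · omega
    · exfalso
      rcases h11 c h7 h8 d h9 h10 with h12 | h12 <;> ring_nf at h12 h1 h2 <;> omega
  · intro h x _ _ y _ _
    by_cases hM : hnfLattice A b m x y
    · by_cases h0 : x = 0 ∧ y = 0
      · exact .inl (.inr h0)
      · refine .inr fun c _ _ d _ _ => ?_
        by_contra! hcon
        have := h (c + x) (d + y) c d (by nlinarith) (by nlinarith) (by simpa using hM)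
        omega
    · exact .inl (.inl hM)

/-- Covering is invariant under lattice translations, and the box `[0, A) × [0, m)` meets every
coset. -/
theorem coversTest_eq_true_iff {A b m k s : ℤ} (hA : 0 < A) (hm : 0 < m) (hk0 : 0 ≤ k)
    (hk : s < (k + 1) ^ 2) :
    coversTest A b m k s = true ↔ Covers (hnfLattice A b m) s := by
  simp only [coversTest, allIcc_eq_true_iff, anyIcc_eq_true_iff, Bool.and_eq_true,
    decide_eq_true_eq, hnfMem_eq_true_iff hA]
  constructor
  · intro h x y
    obtain ⟨c, _, _, d, _, _, h1, h2⟩ := h (x % A) (Int.emod_nonneg _ hA.ne')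
      (by have := Int.emod_lt_of_pos x hA; omega) ((y - x / A * b) % m)
      (Int.emod_nonneg _ hm.ne') (by have := Int.emod_lt_of_pos (y - x / A * b) hm; omega)
    refine ⟨c, d, by rw [pow_two, pow_two]; exact h1, ?_⟩
    have h3 : hnfLattice A b m (x / A * A) (x / A * b + (y - x / A * b) / m * m) := ⟨_, _, rfl, rfl⟩
    convert hnfLattice_add h2 h3 using 1
    · linear_combination -(Int.emod_add_mul_ediv x A)
    · linear_combination -(Int.emod_add_mul_ediv (y - x / A * b) m)
  · intro h x _ _ y _ _
    obtain ⟨c, d, h1, h2⟩ := h x y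
    obtain ⟨⟨h3, h4⟩, h5, h6⟩ := abs_le_of_sq_add_sq_le h1 hk hk0
    exact ⟨c, h3, h4, d, h5, h6, by rw [← pow_two, ← pow_two]; exact h1, h2⟩

/-- Boolean test that no sum of two squares lies strictly between `s` and `t`. -/
def gapTest (k s t : ℤ) : Bool :=
  allIcc (s + 1) (t - 1) fun n => allIcc (-k) k fun c => allIcc (-k) k fun d =>
    !(c * c + d * d == n)

/-- Boolean test for quasi-perfection of `hnfLattice A b m`. -/
def quasiPerfectTest (A b m k s t : ℤ) : Bool :=
  decide (0 < A) && decide (0 < m) && decide (0 ≤ k) && decide (t < (k + 1) ^ 2) &&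
    decide (1 ≤ s) && decide (s < t) && gapTest k s t &&
    packsTest A b m k s && !packsTest A b m k t && coversTest A b m k t && !coversTest A b m k s

theorem quasiPerfectAt_of_test {A b m k s t : ℤ} (h : quasiPerfectTest A b m k s t = true)
    (hs : SumSq s) (ht : SumSq t) : QuasiPerfectAt (hnfLattice A b m) s t := by
  simp only [quasiPerfectTest, Bool.and_eq_true, decide_eq_true_eq, Bool.not_eq_true',
    ← Bool.not_eq_true] at h
  obtain ⟨⟨⟨⟨⟨⟨⟨⟨⟨⟨hA, hm⟩, hk0⟩, hk⟩, h1⟩, hst⟩, hg⟩, hp⟩, hnp⟩, hc⟩, hnc⟩ := h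
  rw [packsTest_eq_true_iff hA hk0 (hst.trans hk)] at hp
  rw [packsTest_eq_true_iff hA hk0 hk] at hnp
  rw [coversTest_eq_true_iff hA hm hk0 hk] at hc
  rw [coversTest_eq_true_iff hA hm hk0 (hst.trans hk)] at hnc
  refine ⟨h1, hst, hs, ht, ?_, hp, hnp, hc, hnc⟩
  rintro n ⟨c, d, hcd⟩ hsn
  by_contra! hnt
  simp only [gapTest, allIcc_eq_true_iff, Bool.not_eq_true', beq_eq_false_iff_ne] at hg
  obtain ⟨⟨h3, h4⟩, h5, h6⟩ := abs_le_of_sq_add_sq_le (hcd.le.trans hnt.le) hk hk0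
  exact hg n (by omega) (by omega) c h3 h4 d h5 h6 (by rw [← hcd]; ring)

/-! ### The listed lattices and the perfect lattices -/

/-- A lattice in Hermite normal form together with its squared packing and covering radii. -/
structure LatticeDatum where
  /-- the upper left entry -/
  A : ℤ
  /-- the upper right entry -/
  b : ℤ
  /-- the lower right entry -/
  m : ℤ
  /-- the squared packing radius -/
  s : ℤ
  /-- the squared covering radius -/
  t : ℤ

/-- The quasi-perfect lattices of the classification. -/
def quasiPerfectData : List LatticeDatum :=
  [⟨1, 2, 6, 1, 2⟩, ⟨1, 2, 7, 1, 2⟩, ⟨1, 3, 7, 1, 2⟩, ⟨1, 3, 8, 1, 2⟩, ⟨1, 3, 11, 2, 4⟩,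
   ⟨1, 4, 11, 2, 4⟩, ⟨2, 3, 6, 2, 4⟩, ⟨1, 4, 14, 4, 5⟩, ⟨1, 4, 15, 4, 5⟩, ⟨1, 6, 15, 4, 5⟩,
   ⟨1, 6, 16, 4, 5⟩, ⟨1, 4, 17, 4, 5⟩, ⟨1, 5, 17, 4, 5⟩, ⟨1, 7, 17, 4, 5⟩, ⟨1, 4, 18, 4, 5⟩,
   ⟨1, 5, 18, 4, 5⟩, ⟨1, 7, 18, 4, 5⟩, ⟨1, 4, 19, 4, 5⟩, ⟨1, 5, 19, 4, 5⟩, ⟨1, 8, 20, 4, 5⟩,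
   ⟨1, 5, 23, 5, 8⟩, ⟨1, 9, 23, 5, 8⟩, ⟨1, 5, 24, 5, 8⟩, ⟨1, 6, 33, 9, 10⟩, ⟨1, 6, 34, 9, 10⟩,
   ⟨1, 10, 35, 9, 10⟩, ⟨1, 7, 39, 10, 13⟩, ⟨1, 11, 39, 10, 13⟩, ⟨1, 12, 42, 10, 13⟩,
   ⟨1, 8, 53, 16, 17⟩, ⟨1, 20, 53, 16, 17⟩, ⟨1, 9, 77, 20, 25⟩, ⟨1, 17, 77, 20, 25⟩]

theorem exists_datum_of_mem_generators :
    ∀ B ∈ generatorsA ∪ generatorsExtra, ∃ d ∈ quasiPerfectData, B = !![d.A, d.b; 0, d.m] := by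
  decide +kernel

theorem mem_generators_of_datum :
    ∀ d ∈ quasiPerfectData, !![d.A, d.b; 0, d.m] ∈ generatorsA ∪ generatorsExtra := by
  decide +kernel

/-- The box size is only required to satisfy `t < (k + 1) ^ 2`; the case split keeps the searches
small. -/
theorem quasiPerfectData_test : (quasiPerfectData.all fun d => quasiPerfectTest d.A d.b d.m
    (if d.t < 4 then 1 else if d.t < 9 then 2 else if d.t < 16 then 3 else 5) d.s d.t) = true := by
  decide +kernel

theorem quasiPerfectData_radius : ∀ d ∈ quasiPerfectData,
    (d.s, d.t) ∈ [((1 : ℤ), (2 : ℤ)), (2, 4), (4, 5), (5, 8), (9, 10), (10, 13), (16, 17), (20, 25)] := by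
  decide +kernel

theorem quasiPerfectData_quasiPerfectAt (d : LatticeDatum) (hd : d ∈ quasiPerfectData) :
    QuasiPerfectAt (hnfLattice d.A d.b d.m) d.s d.t := by
  have h := quasiPerfectData_radius d hd
  have htest := (List.all_eq_true.1 quasiPerfectData_test) d hd
  simp only [List.mem_cons, Prod.mk.injEq, List.not_mem_nil, or_false] at h
  apply quasiPerfectAt_of_test htest
  · rcases h with h | h | h | h | h | h | h | h <;> rw [h.1]
    exacts [⟨1, 0, rfl⟩, ⟨1, 1, rfl⟩, ⟨2, 0, rfl⟩, ⟨2, 1, rfl⟩, ⟨3, 0, rfl⟩, ⟨3, 1, rfl⟩,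
      ⟨4, 0, rfl⟩, ⟨4, 2, rfl⟩]
  · rcases h with h | h | h | h | h | h | h | h <;> rw [h.2]
    exacts [⟨1, 1, rfl⟩, ⟨2, 0, rfl⟩, ⟨2, 1, rfl⟩, ⟨2, 2, rfl⟩, ⟨3, 1, rfl⟩, ⟨3, 2, rfl⟩,
      ⟨4, 1, rfl⟩, ⟨5, 0, rfl⟩]

/-- Perfect lattices: the first radius is both a packing and a covering radius. -/
def perfectData : List LatticeDatum :=
  [⟨1, 2, 5, 1, 1⟩, ⟨3, 0, 3, 2, 2⟩, ⟨1, 3, 9, 2, 2⟩, ⟨1, 5, 13, 4, 4⟩, ⟨5, 0, 5, 8, 8⟩,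
   ⟨1, 5, 25, 8, 8⟩, ⟨1, 10, 25, 8, 8⟩]

theorem perfectData_test : (perfectData.all fun d => decide (0 < d.A) && decide (0 < d.m) &&
    decide (d.s < (2 + 1) ^ 2) && packsTest d.A d.b d.m 2 d.s &&
    coversTest d.A d.b d.m 2 d.s) = true := by
  decide +kernel

theorem perfectData_sumSq : ∀ d ∈ perfectData, d.s ∈ [(1 : ℤ), 2, 4, 8] := by
  decide +kernel

/-- Let `d.s` be the common packing and covering value. If `d.s ≤ s`, then `s` already covers;
otherwise the gap condition gives `t ≤ d.s`, so `t` still packs. -/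
theorem perfectData_not_quasiPerfectAt (d : LatticeDatum) (hd : d ∈ perfectData) (s t : ℤ) :
    ¬ QuasiPerfectAt (hnfLattice d.A d.b d.m) s t := by
  intro h
  have htest := (List.all_eq_true.1 perfectData_test) d hd
  simp only [Bool.and_eq_true, decide_eq_true_eq] at htest
  obtain ⟨⟨⟨⟨hA, hm⟩, h0⟩, hp⟩, hc⟩ := htest
  rw [packsTest_eq_true_iff hA (by norm_num) h0] at hp
  rw [coversTest_eq_true_iff hA hm (by norm_num) h0] at hc
  have hs : SumSq d.s := by
    have := perfectData_sumSq d hd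
    simp only [List.mem_cons, List.not_mem_nil, or_false] at this
    rcases this with h | h | h | h <;> rw [h]
    exacts [⟨1, 0, rfl⟩, ⟨1, 1, rfl⟩, ⟨2, 0, rfl⟩, ⟨2, 2, rfl⟩]
  rcases le_or_gt d.s s with hle | hgt
  · exact h.not_covers (hc.mono hle)
  · exact h.not_packs (hp.mono (h.gap _ hs hgt))

/-! ### Splitting lattice vectors: upper bounds on the covering radius -/

/-- The least `s` such that `(x, y)` is a difference of two points of squared norm at most `s`. -/
def splitNorm (x y : ℤ) : ℤ :=
  let p := x.natAbs
  let q := y.natAbs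
  if p % 2 = 1 ∧ q % 2 = 1 then
    if q ≤ p then (((p / 2 + 1) * (p / 2 + 1) + (q / 2) * (q / 2) : ℕ) : ℤ)
    else (((p / 2) * (p / 2) + (q / 2 + 1) * (q / 2 + 1) : ℕ) : ℤ)
  else ((((p + 1) / 2) * ((p + 1) / 2) + ((q + 1) / 2) * ((q + 1) / 2) : ℕ) : ℤ)

theorem splitNorm_sumSq (x y : ℤ) : SumSq (splitNorm x y) := by
  unfold splitNorm
  dsimp only
  split_ifs
  · exact ⟨(x.natAbs / 2 + 1 : ℕ), (y.natAbs / 2 : ℕ), by push_cast; ring⟩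
  · exact ⟨(x.natAbs / 2 : ℕ), (y.natAbs / 2 + 1 : ℕ), by push_cast; ring⟩
  · exact ⟨((x.natAbs + 1) / 2 : ℕ), ((y.natAbs + 1) / 2 : ℕ), by push_cast; ring⟩

theorem exists_split (x y : ℤ) : ∃ a b c d : ℤ, a - c = x ∧ b - d = y ∧
    a ^ 2 + b ^ 2 ≤ splitNorm x y ∧ c ^ 2 + d ^ 2 ≤ splitNorm x y := by
  obtain ⟨e, he⟩ : ∃ e : ℤˣ, x = e * (x.natAbs : ℤ) := by
    rcases Int.natAbs_eq x with h | h
    · exact ⟨1, by simpa using h⟩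
    · exact ⟨-1, by simpa using h⟩
  obtain ⟨f, hf⟩ : ∃ f : ℤˣ, y = f * (y.natAbs : ℤ) := by
    rcases Int.natAbs_eq y with h | h
    · exact ⟨1, by simpa using h⟩
    · exact ⟨-1, by simpa using h⟩
  suffices h : ∃ a b c d : ℤ, a - c = x.natAbs ∧ b - d = y.natAbs ∧
      a ^ 2 + b ^ 2 ≤ splitNorm x y ∧ c ^ 2 + d ^ 2 ≤ splitNorm x y by
    obtain ⟨a, b, c, d, h1, h2, h3, h4⟩ := h
    refine ⟨e * a, f * b, e * c, f * d, ?_, ?_, ?_, ?_⟩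
    · rw [← mul_sub, h1, ← he]
    · rw [← mul_sub, h2, ← hf]
    · simpa only [Int.units_mul_sq] using h3
    · simpa only [Int.units_mul_sq] using h4
  unfold splitNorm
  dsimp only
  generalize x.natAbs = p
  generalize y.natAbs = q
  split_ifs with h h'
  · obtain ⟨k, rfl⟩ : ∃ k, p = 2 * k + 1 := ⟨p / 2, by omega⟩
    obtain ⟨l, rfl⟩ : ∃ l, q = 2 * l + 1 := ⟨q / 2, by omega⟩
    rw [show (2 * k + 1) / 2 = k by omega, show (2 * l + 1) / 2 = l by omega]
    -- When both coordinates are odd, the two rounding units go to different points, so neither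
    -- point carries both.
    exact ⟨k + 1, l, -k, -l - 1, by push_cast; ring, by push_cast; ring, by push_cast; nlinarith,
      by push_cast; nlinarith⟩
  · obtain ⟨k, rfl⟩ : ∃ k, p = 2 * k + 1 := ⟨p / 2, by omega⟩
    obtain ⟨l, rfl⟩ : ∃ l, q = 2 * l + 1 := ⟨q / 2, by omega⟩
    rw [show (2 * k + 1) / 2 = k by omega, show (2 * l + 1) / 2 = l by omega]
    exact ⟨k + 1, l, -k, -l - 1, by push_cast; ring, by push_cast; ring, by push_cast; nlinarith,
      by push_cast; nlinarith⟩
  · refine ⟨((p + 1) / 2 : ℕ), ((q + 1) / 2 : ℕ), -(p / 2 : ℕ), -(q / 2 : ℕ), by omega, by omega,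
      by push_cast; nlinarith, ?_⟩
    have h1 : p / 2 ≤ (p + 1) / 2 := by omega
    have h2 : q / 2 ≤ (q + 1) / 2 := by omega
    rw [neg_sq, neg_sq, pow_two, pow_two]
    exact_mod_cast add_le_add (Nat.mul_le_mul h1 h1) (Nat.mul_le_mul h2 h2)

/-- Halving exactly would give `x ^ 2 + y ^ 2`. Rounding up adds a linear term, which `y ≤ x` lets
one express through `x` alone. -/
theorem four_mul_splitNorm_le {x y : ℤ} (hy : 0 ≤ y) (hyx : y ≤ x) :
    4 * splitNorm x y ≤ x ^ 2 + y ^ 2 + 2 * x + 2 := by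
  lift y to ℕ using hy
  lift x to ℕ using (by omega)
  unfold splitNorm
  dsimp only
  simp only [Int.natAbs_natCast]
  have hyx : y ≤ x := by exact_mod_cast hyx
  split_ifs with h
  · obtain ⟨k, rfl⟩ : ∃ k, x = 2 * k + 1 := ⟨x / 2, by omega⟩
    obtain ⟨l, rfl⟩ : ∃ l, y = 2 * l + 1 := ⟨y / 2, by omega⟩
    rw [show (2 * k + 1) / 2 = k by omega, show (2 * l + 1) / 2 = l by omega]
    push_cast
    nlinarith
  · rcases Nat.even_or_odd' x with ⟨k, rfl | rfl⟩ <;> rcases Nat.even_or_odd' y with ⟨l, rfl | rfl⟩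
    · rw [show (2 * k + 1) / 2 = k by omega, show (2 * l + 1) / 2 = l by omega]
      push_cast
      nlinarith
    · rw [show (2 * k + 1) / 2 = k by omega, show (2 * l + 1 + 1) / 2 = l + 1 by omega]
      push_cast
      nlinarith
    · rw [show (2 * k + 1 + 1) / 2 = k + 1 by omega, show (2 * l + 1) / 2 = l by omega]
      push_cast
      nlinarith
    · omega

/-- The two halves of a nonzero lattice vector witness failure of packing at a sum of two squares.
That value is therefore beyond `s`, and `t` is the first such. -/
theorem QuasiPerfectAt.le_splitNorm {M : ℤ → ℤ → Prop} {s t : ℤ} (h : QuasiPerfectAt M s t)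
    {x y : ℤ} (hM : M x y) (h0 : x ≠ 0 ∨ y ≠ 0) : t ≤ splitNorm x y := by
  by_contra! hlt
  have hle : splitNorm x y ≤ s := by
    by_contra! hs
    exact absurd (h.gap _ (splitNorm_sumSq x y) hs) (not_le.2 hlt)
  obtain ⟨a, b, c, d, rfl, rfl, h1, h2⟩ := exists_split x y
  have := h.packs a b c d (h1.trans hle) (h2.trans hle) hM
  omega

/-! ### Gauss reduction -/

/-- `(u₁, u₂), (v₁, v₂)` is a Gauss-reduced basis of `M` enclosing a nonobtuse angle. -/
structure ReducedBasis (M : ℤ → ℤ → Prop) (u₁ u₂ v₁ v₂ : ℤ) : Prop where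
  mem_iff : ∀ x y, M x y ↔ ∃ i j : ℤ, x = i * u₁ + j * v₁ ∧ y = i * u₂ + j * v₂
  det_ne_zero : u₁ * v₂ - u₂ * v₁ ≠ 0
  dot_nonneg : 0 ≤ u₁ * v₁ + u₂ * v₂
  two_dot_le : 2 * (u₁ * v₁ + u₂ * v₂) ≤ u₁ ^ 2 + u₂ ^ 2
  norm_le : u₁ ^ 2 + u₂ ^ 2 ≤ v₁ ^ 2 + v₂ ^ 2

theorem exists_round (a : ℤ) {D : ℤ} (hD : D ≠ 0) : ∃ i : ℤ, (2 * (a - i * D)) ^ 2 ≤ D ^ 2 := by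
  have h : |(a : ℚ) / D - round ((a : ℚ) / D)| ≤ 1 / 2 := abs_sub_round _
  refine ⟨round ((a : ℚ) / D), ?_⟩
  have hD' : (D : ℚ) ≠ 0 := by exact_mod_cast hD
  have h2 : ((2 * (a - round ((a : ℚ) / D) * D) : ℤ) : ℚ) =
      2 * ((a : ℚ) / D - round ((a : ℚ) / D)) * D := by
    push_cast
    field_simp
  have h3 : (((2 * (a - round ((a : ℚ) / D) * D)) ^ 2 : ℤ) : ℚ) ≤ ((D ^ 2 : ℤ) : ℚ) := by
    rw [Int.cast_pow, h2, Int.cast_pow, ← sq_abs, ← sq_abs (D : ℚ), abs_mul, abs_mul, abs_two]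
    apply pow_le_pow_left₀ (by positivity)
    nlinarith [abs_nonneg (D : ℚ)]
  exact_mod_cast h3

theorem exists_min_norm (P : ℤ → ℤ → Prop) (h : ∃ x y, P x y) :
    ∃ x y, P x y ∧ ∀ x' y', P x' y' → x ^ 2 + y ^ 2 ≤ x' ^ 2 + y' ^ 2 := by
  classical
  have hex : ∃ n : ℕ, ∃ x y, P x y ∧ (x ^ 2 + y ^ 2).toNat = n := by
    obtain ⟨x, y, h⟩ := h
    exact ⟨_, x, y, h, rfl⟩
  obtain ⟨x, y, hP, hn⟩ := Nat.find_spec hex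
  refine ⟨x, y, hP, fun x' y' hP' => ?_⟩
  have := Nat.find_min' hex ⟨x', y', hP', rfl⟩
  rw [← hn] at this
  have h1 := add_nonneg (sq_nonneg x) (sq_nonneg y)
  have h2 := add_nonneg (sq_nonneg x') (sq_nonneg y')
  omega

/-- Take `u` shortest among nonzero vectors and `v` shortest among those not parallel to `u`, with
the sign of `v` chosen to make the dot product nonnegative. Minimality against `v - u` bounds the
dot product. -/
theorem exists_reducedBasis_memPred (L : AddSubgroup (Fin 2 → ℤ)) (hL : HasRankTwo (memPred L)) :
    ∃ u₁ u₂ v₁ v₂, ReducedBasis (memPred L) u₁ u₂ v₁ v₂ := by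
  have hsub : ∀ {a b c d : ℤ}, memPred L a b → memPred L c d → memPred L (a - c) (b - d) := by
    intro a b c d h1 h2
    have := L.sub_mem h1 h2
    simpa [memPred] using this
  have hadd : ∀ {a b c d : ℤ}, memPred L a b → memPred L c d → memPred L (a + c) (b + d) := by
    intro a b c d h1 h2
    have := L.add_mem h1 h2
    simpa [memPred] using this
  have hmul : ∀ (i : ℤ) {a b : ℤ}, memPred L a b → memPred L (i * a) (i * b) := by
    intro i a b h1
    have := L.zsmul_mem h1 i
    simpa [memPred] using this
  obtain ⟨a, b, c, d, hab, hcd, hdet⟩ := hL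
  obtain ⟨u₁, u₂, ⟨hu, hu0⟩, humin⟩ := exists_min_norm
    (fun x y => memPred L x y ∧ (x ≠ 0 ∨ y ≠ 0)) ⟨a, b, hab, by
      by_contra! h
      rw [h.1, h.2] at hdet
      simp at hdet⟩
  have hupos : 0 < u₁ ^ 2 + u₂ ^ 2 := by
    rcases hu0 with h | h <;> positivity
  obtain ⟨v₁, v₂, ⟨hv, hv0⟩, hvmin⟩ := exists_min_norm
    (fun x y => memPred L x y ∧ u₁ * y - u₂ * x ≠ 0) (by
      by_contra! h
      have h1 := h a b hab
      have h2 := h c d hcd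
      apply hdet
      have h3 : u₁ * (a * d - b * c) = 0 := by linear_combination a * h2 - c * h1
      have h4 : u₂ * (a * d - b * c) = 0 := by linear_combination b * h2 - d * h1
      rcases hu0 with h5 | h5
      · exact (mul_eq_zero.1 h3).resolve_left h5
      · exact (mul_eq_zero.1 h4).resolve_left h5)
  obtain ⟨v₁, v₂, hv, hv0, hvmin, hdot⟩ : ∃ v₁ v₂, memPred L v₁ v₂ ∧ u₁ * v₂ - u₂ * v₁ ≠ 0 ∧
      (∀ x' y', memPred L x' y' ∧ u₁ * y' - u₂ * x' ≠ 0 → v₁ ^ 2 + v₂ ^ 2 ≤ x' ^ 2 + y' ^ 2) ∧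
      0 ≤ u₁ * v₁ + u₂ * v₂ := by
    rcases le_total 0 (u₁ * v₁ + u₂ * v₂) with h | h
    · exact ⟨v₁, v₂, hv, hv0, hvmin, h⟩
    · refine ⟨-v₁, -v₂, by simpa using hmul (-1) hv, ?_, by simpa using hvmin, by linarith⟩
      contrapose! hv0
      linarith
  have hle : u₁ ^ 2 + u₂ ^ 2 ≤ v₁ ^ 2 + v₂ ^ 2 := humin _ _ ⟨hv, by
    by_contra! h
    rw [h.1, h.2] at hv0
    simp at hv0⟩
  have h2dot : 2 * (u₁ * v₁ + u₂ * v₂) ≤ u₁ ^ 2 + u₂ ^ 2 := by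
    have := hvmin (v₁ - u₁) (v₂ - u₂) ⟨hsub hv hu, by
      contrapose! hv0
      linarith⟩
    nlinarith
  refine ⟨u₁, u₂, v₁, v₂, ⟨fun x y => ⟨fun hM => ?_, ?_⟩, hv0, hdot, h2dot, hle⟩⟩
  · set D := u₁ * v₂ - u₂ * v₁ with hD
    obtain ⟨i, hi⟩ := exists_round (x * v₂ - y * v₁) hv0
    obtain ⟨j, hj⟩ := exists_round (u₁ * y - u₂ * x) hv0
    have hw := hsub (hsub hM (hmul i hu)) (hmul j hv)
    set x' := x - i * u₁ - j * v₁ with hx'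
    set y' := y - i * u₂ - j * v₂ with hy'
    -- By Cramer's rule `α` and `β` are `D` times the coordinates of the remainder in the basis `u,
    -- v`; rounding makes them at most `|D| / 2` in absolute value.
    set α := x * v₂ - y * v₁ - i * D with hα
    set β := u₁ * y - u₂ * x - j * D with hβ
    have hDpos : 0 < D ^ 2 := by positivity
    have e1 : D * x' = α * u₁ + β * v₁ := by rw [hα, hβ, hx', hD]; ring
    have e2 : D * y' = α * u₂ + β * v₂ := by rw [hα, hβ, hy', hD]; ring
    have e3 : D ^ 2 * (x' ^ 2 + y' ^ 2) = α ^ 2 * (u₁ ^ 2 + u₂ ^ 2) +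
        2 * (α * β) * (u₁ * v₁ + u₂ * v₂) + β ^ 2 * (v₁ ^ 2 + v₂ ^ 2) := by
      linear_combination (D * x' + α * u₁ + β * v₁) * e1 + (D * y' + α * u₂ + β * v₂) * e2
    have hb0 : β = u₁ * y' - u₂ * x' := by rw [hβ, hx', hy', hD]; ring
    -- The remainder has squared norm at most `3/4` of that of `v`, so by minimality of `v` it is
    -- parallel to `u`. It is then at most half as long as `u`, hence zero.
    have hβ0 : β = 0 := by
      by_contra hne
      have h5 := hvmin x' y' ⟨hw, by rw [← hb0]; exact hne⟩
      have h6 : 8 * (α * β) ≤ 2 * D ^ 2 := by nlinarith [sq_nonneg (α - β)]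
      have h7 := mul_le_mul_of_nonneg_right h6 hdot
      have h8 := mul_le_mul_of_nonneg_left h2dot hDpos.le
      have h9 := mul_le_mul_of_nonneg_right hi hupos.le
      have h10 := mul_le_mul_of_nonneg_right hj (hupos.le.trans hle)
      have h11 := mul_le_mul_of_nonneg_left hle hDpos.le
      have h12 := mul_le_mul_of_nonneg_left h5 hDpos.le
      have h13 : 0 < D ^ 2 * (v₁ ^ 2 + v₂ ^ 2) := mul_pos hDpos (hupos.trans_le hle)
      linarith
    have hxy : ¬(x' ≠ 0 ∨ y' ≠ 0) := by
      intro hne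
      have h5 := humin x' y' ⟨hw, hne⟩
      rw [hβ0] at e3
      have h9 := mul_le_mul_of_nonneg_right hi hupos.le
      have h12 := mul_le_mul_of_nonneg_left h5 hDpos.le
      have h13 : 0 < D ^ 2 * (u₁ ^ 2 + u₂ ^ 2) := mul_pos hDpos hupos
      linarith
    push Not at hxy
    exact ⟨i, j, by linarith [hxy.1], by linarith [hxy.2]⟩
  · rintro ⟨i, j, rfl, rfl⟩
    exact hadd (hmul i hu) (hmul j hv)

/-! ### Circumcenters and uncovered points -/

theorem cross_sq_le {p q K : ℤ} (x y : ℤ) (h : p ^ 2 + q ^ 2 ≤ K) :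
    (p * y - q * x) ^ 2 ≤ K * (x ^ 2 + y ^ 2) := by
  have h1 := mul_le_mul_of_nonneg_right h (add_nonneg (sq_nonneg x) (sq_nonneg y))
  have h2 : (p * y - q * x) ^ 2 = (p ^ 2 + q ^ 2) * (x ^ 2 + y ^ 2) - (p * x + q * y) ^ 2 := by
    ring
  have h3 := sq_nonneg (p * x + q * y)
  linarith

/-- The quotient `γ / D` lies in `[0, 1]` and differs from the integer `k` by less than 1. -/
theorem eq_zero_or_one_of_sq_lt {D γ k : ℤ} (h1 : 0 ≤ D * γ) (h2 : D * γ ≤ D ^ 2)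
    (h3 : (γ - k * D) ^ 2 < D ^ 2) : k = 0 ∨ k = 1 := by
  have hDpos : 0 < D ^ 2 := (sq_nonneg _).trans_lt h3
  have h5 : (D * γ - k * D ^ 2) ^ 2 < (D ^ 2) ^ 2 := by
    have h6 : (D * γ - k * D ^ 2) ^ 2 = D ^ 2 * (γ - k * D) ^ 2 := by ring
    rw [h6, sq (D ^ 2)]
    exact mul_lt_mul_of_pos_left h3 hDpos
  obtain ⟨h6, h7⟩ := abs_lt.1 (sq_lt_sq.1 h5 |>.trans_eq (abs_of_pos hDpos))
  generalize D ^ 2 = E at *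
  have h8 : -1 < k := by nlinarith
  have h9 : k < 2 := by nlinarith
  omega

/-- The expression is `|c - w|² - |c|²` for `w = i u + j v` and `c` the circumcenter of `0, u, v`,
with `a = |u|²`, `b = |v|²`, `t = u · v`. For `i * j < 0`, replacing `b` and `2 * t` by `a` only
lowers it, and leaves `a` times an integer form that is nonnegative there. -/
theorem delaunay_nonneg {a b t : ℤ} (i j : ℤ) (ha0 : 0 ≤ a) (hle : a ≤ b) (hdot : 0 ≤ t)
    (h2dot : 2 * t ≤ a) : 0 ≤ (i ^ 2 - i) * a + (j ^ 2 - j) * b + 2 * (i * j) * t := by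
  have hi0 : 0 ≤ i ^ 2 - i := by
    rcases le_or_gt i 0 with h | h <;> nlinarith
  have hj0 : 0 ≤ j ^ 2 - j := by
    rcases le_or_gt j 0 with h | h <;> nlinarith
  have hb' := mul_le_mul_of_nonneg_left hle hj0
  rcases le_or_gt 0 (i * j) with hij | hij
  · have h1 := mul_nonneg hi0 ha0
    have h2 := mul_nonneg hj0 (ha0.trans hle)
    have h3 := mul_nonneg hij hdot
    linarith
  · have h3 := mul_le_mul_of_nonpos_left h2dot hij.le
    have h4 : 0 ≤ i ^ 2 - i + j ^ 2 - j + i * j := by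
      rcases lt_or_gt_of_ne (show i ≠ 0 by rintro rfl; simp at hij) with hi' | hi'
      · nlinarith [sq_nonneg (2 * j + i - 1)]
      · have : j < 0 := by nlinarith
        nlinarith [sq_nonneg (2 * i + j - 1)]
    have h5 := mul_nonneg h4 ha0
    linarith

namespace ReducedBasis

variable {M : ℤ → ℤ → Prop} {u₁ u₂ v₁ v₂ : ℤ}

theorem neg_left (h : ReducedBasis M u₁ u₂ v₁ v₂) :
    ReducedBasis (fun x y => M (-x) y) (-u₁) u₂ (-v₁) v₂ := by
  obtain ⟨h1, h2, h3, h4, h5⟩ := h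
  refine ⟨fun x y => ?_, fun h => h2 (by linarith), by linarith, by linarith, by linarith⟩
  rw [h1]
  refine exists_congr fun i => exists_congr fun j => and_congr_left' ?_
  constructor <;> intro h <;> linarith

theorem neg_right (h : ReducedBasis M u₁ u₂ v₁ v₂) :
    ReducedBasis (fun x y => M x (-y)) u₁ (-u₂) v₁ (-v₂) := by
  obtain ⟨h1, h2, h3, h4, h5⟩ := h
  refine ⟨fun x y => ?_, fun h => h2 (by linarith), by linarith, by linarith, by linarith⟩
  rw [h1]
  refine exists_congr fun i => exists_congr fun j => and_congr_right' ?_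
  constructor <;> intro h <;> linarith

theorem swap (h : ReducedBasis M u₁ u₂ v₁ v₂) :
    ReducedBasis (fun x y => M y x) u₂ u₁ v₂ v₁ := by
  obtain ⟨h1, h2, h3, h4, h5⟩ := h
  refine ⟨fun x y => ?_, fun h => h2 (by linarith), by linarith, by linarith, by linarith⟩
  rw [h1]
  exact exists_congr fun i => exists_congr fun j => and_comm

theorem exists_octant (h : ReducedBasis M u₁ u₂ v₁ v₂) :
    ∃ (N : ℤ → ℤ → Prop) (a b c d : ℤ), SignedCongruent N M ∧ ReducedBasis N a b c d ∧
      0 ≤ b ∧ b ≤ a := by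
  have h1 : ∃ (N : ℤ → ℤ → Prop) (a b c d : ℤ), SignedCongruent N M ∧ ReducedBasis N a b c d ∧
      0 ≤ a := by
    rcases le_total 0 u₁ with h0 | h0
    · exact ⟨M, _, _, _, _, ⟨1, 1, false, by simp [signedPerm]⟩, h, h0⟩
    · exact ⟨_, _, _, _, _, ⟨-1, 1, false, by simp [signedPerm]⟩, h.neg_left, by linarith⟩
  obtain ⟨N, a, b, c, d, hN, h, ha⟩ := h1
  have h2 : ∃ (N : ℤ → ℤ → Prop) (a b c d : ℤ), SignedCongruent N M ∧ ReducedBasis N a b c d ∧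
      0 ≤ a ∧ 0 ≤ b := by
    rcases le_total 0 b with h0 | h0
    · exact ⟨N, _, _, _, _, hN, h, ha, h0⟩
    · exact ⟨_, _, _, _, _, .trans ⟨1, -1, false, by simp [signedPerm]⟩ hN, h.neg_right, ha,
        by linarith⟩
  obtain ⟨N, a, b, c, d, hN, h, ha, hb⟩ := h2
  rcases le_total b a with h0 | h0
  · exact ⟨N, _, _, _, _, hN, h, hb, h0⟩
  · exact ⟨_, _, _, _, _, .trans ⟨1, 1, true, by simp [signedPerm]⟩ hN, h.swap, ha, h0⟩

/-- An integer form of the comparison of the circumradius of the triangle `0, u, v` with the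
covering radius. -/
theorem circumradius_le (h : ReducedBasis M u₁ u₂ v₁ v₂) {K : ℤ} (hK : Covers M K) :
    ∃ m : ℤ, 0 ≤ m ∧ m ^ 2 ≤ 2 * K ∧
      (u₁ ^ 2 + u₂ ^ 2) * (v₁ ^ 2 + v₂ ^ 2) *
        (u₁ ^ 2 + u₂ ^ 2 + (v₁ ^ 2 + v₂ ^ 2) - 2 * (u₁ * v₁ + u₂ * v₂)) ≤
      (u₁ * v₂ - u₂ * v₁) ^ 2 * (4 * K + 4 * m + 2) := by
  obtain ⟨hmem, hdet, hdot, h2dot, hle⟩ := h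
  set a := u₁ ^ 2 + u₂ ^ 2 with ha
  set b := v₁ ^ 2 + v₂ ^ 2 with hb
  set t := u₁ * v₁ + u₂ * v₂ with ht
  set D := u₁ * v₂ - u₂ * v₁ with hD
  -- The circumcenter is `(Q₁, Q₂) / (2 * D)`; below, `z` is its rounding and `e / (2 * D)` the
  -- rounding error.
  set Q₁ := a * v₂ - b * u₂ with hQ₁
  set Q₂ := b * u₁ - a * v₁ with hQ₂
  have ha0 : 0 ≤ a := by positivity
  obtain ⟨z₁, hz₁⟩ := exists_round Q₁ (mul_ne_zero two_ne_zero hdet)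
  obtain ⟨z₂, hz₂⟩ := exists_round Q₂ (mul_ne_zero two_ne_zero hdet)
  obtain ⟨q₁, q₂, hq, hw⟩ := hK z₁ z₂
  obtain ⟨i, j, hi, hj⟩ := (hmem _ _).1 hw
  set e₁ := Q₁ - z₁ * (2 * D) with he₁
  set e₂ := Q₂ - z₂ * (2 * D) with he₂
  have hE₁ : e₁ ^ 2 ≤ D ^ 2 := by
    rw [mul_pow, mul_pow 2 D] at hz₁
    linarith
  have hE₂ : e₂ ^ 2 ≤ D ^ 2 := by
    rw [mul_pow, mul_pow 2 D] at hz₂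
    linarith
  have hDelaunay := delaunay_nonneg i j ha0 hle hdot h2dot
  have hN : Q₁ ^ 2 + Q₂ ^ 2 = a * b * (a + b - 2 * t) := by
    rw [hQ₁, hQ₂, ha, hb, ht]; ring
  have hexp : (e₁ + 2 * D * q₁) ^ 2 + (e₂ + 2 * D * q₂) ^ 2 = Q₁ ^ 2 + Q₂ ^ 2 +
      4 * D ^ 2 * ((i ^ 2 - i) * a + (j ^ 2 - j) * b + 2 * (i * j) * t) := by
    have h1 : e₁ + 2 * D * q₁ = Q₁ - 2 * D * (i * u₁ + j * v₁) := by
      rw [he₁, ← hi]; ring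
    have h2 : e₂ + 2 * D * q₂ = Q₂ - 2 * D * (i * u₂ + j * v₂) := by
      rw [he₂, ← hj]; ring
    rw [h1, h2, hQ₁, hQ₂, ha, hb, ht, hD]; ring
  have hcross : ∀ e q : ℤ, e ^ 2 ≤ D ^ 2 → D * (e * q) ≤ D ^ 2 * |q| := by
    intro e q h
    have h1 : |e| ≤ |D| := sq_le_sq.1 h
    calc D * (e * q) ≤ |D * (e * q)| := le_abs_self _
      _ = |D| * |e| * |q| := by rw [abs_mul, abs_mul, mul_assoc]
      _ ≤ |D| * |D| * |q| := by gcongr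
      _ = D ^ 2 * |q| := by rw [← sq, sq_abs]
  -- Errors of at most 1/2 per coordinate change `|q|²` by at most `|q₁| + |q₂| + 1/2`. The factor
  -- `4 * D ^ 2` clears denominators.
  refine ⟨|q₁| + |q₂|, by positivity, ?_, ?_⟩
  · have h1 := sq_nonneg (|q₁| - |q₂|)
    have h2 : (|q₁| + |q₂|) ^ 2 = 2 * (|q₁| ^ 2 + |q₂| ^ 2) - (|q₁| - |q₂|) ^ 2 := by ring
    rw [sq_abs, sq_abs] at h2
    linarith
  · have h1 := hcross e₁ q₁ hE₁
    have h2 := hcross e₂ q₂ hE₂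
    have h3 := mul_nonneg (mul_nonneg (by norm_num : (0 : ℤ) ≤ 4) (sq_nonneg D)) hDelaunay
    have h4 := mul_le_mul_of_nonneg_left hq (sq_nonneg D)
    rw [← hN]
    linarith

/-- A point of the fundamental parallelogram far from its four corners is not covered. -/
theorem not_covers_of_hole (h : ReducedBasis M u₁ u₂ v₁ v₂) {K z₁ z₂ D α β : ℤ}
    (hD : D = u₁ * v₂ - u₂ * v₁)
    (hα : α = D * (z₁ * v₂ - z₂ * v₁)) (hβ : β = D * (u₁ * z₂ - u₂ * z₁))
    (hα0 : 0 ≤ α) (hα1 : α ≤ D ^ 2) (hβ0 : 0 ≤ β) (hβ1 : β ≤ D ^ 2)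
    (hu : K * (u₁ ^ 2 + u₂ ^ 2) < D ^ 2) (hv : K * (v₁ ^ 2 + v₂ ^ 2) < D ^ 2)
    (h00 : K < z₁ ^ 2 + z₂ ^ 2) (h10 : K < (z₁ - u₁) ^ 2 + (z₂ - u₂) ^ 2)
    (h01 : K < (z₁ - v₁) ^ 2 + (z₂ - v₂) ^ 2)
    (h11 : K < (z₁ - u₁ - v₁) ^ 2 + (z₂ - u₂ - v₂) ^ 2) : ¬ Covers M K := by
  intro hcov
  obtain ⟨q₁, q₂, hq, hw⟩ := hcov z₁ z₂
  obtain ⟨i, j, hi, hj⟩ := (h.mem_iff _ _).1 hw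
  have hx : z₁ = q₁ + (i * u₁ + j * v₁) := by linarith
  have hy : z₂ = q₂ + (i * u₂ + j * v₂) := by linarith
  -- The basis coordinates of a lattice point within `√K` of `z` differ from those of `z` by less
  -- than 1, so only the four corners of the parallelogram can cover `z`.
  have hci : (z₁ * v₂ - z₂ * v₁ - i * D) ^ 2 ≤ K * (v₁ ^ 2 + v₂ ^ 2) := by
    have : z₁ * v₂ - z₂ * v₁ - i * D = q₁ * v₂ - q₂ * v₁ := by rw [hx, hy, hD]; ring
    rw [this]
    exact cross_sq_le v₁ v₂ hq
  have hcj : (u₁ * z₂ - u₂ * z₁ - j * D) ^ 2 ≤ K * (u₁ ^ 2 + u₂ ^ 2) := by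
    have : u₁ * z₂ - u₂ * z₁ - j * D = -(q₁ * u₂ - q₂ * u₁) := by rw [hx, hy, hD]; ring
    rw [this, neg_sq]
    exact cross_sq_le u₁ u₂ hq
  have hq₁ : q₁ = z₁ - i * u₁ - j * v₁ := by linarith
  have hq₂ : q₂ = z₂ - i * u₂ - j * v₂ := by linarith
  rcases eq_zero_or_one_of_sq_lt (hα ▸ hα0) (hα ▸ hα1) (hci.trans_lt hv) with rfl | rfl <;>
    rcases eq_zero_or_one_of_sq_lt (hβ ▸ hβ0) (hβ ▸ hβ1) (hcj.trans_lt hu) with rfl | rfl <;>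
    simp only [zero_mul, one_mul, sub_zero] at hq₁ hq₂ <;> subst hq₁ hq₂
  · linarith
  · linarith
  · linarith
  · linarith

end ReducedBasis

/-! ### The finite search over reduced bases -/

/-- The splitting norm of `(x, y)` for the halves moved by one unit along the second axis. -/
def shiftedSplitNorm (x y : ℤ) : ℤ :=
  max (((x + 1) / 2) * ((x + 1) / 2) + (y / 2 - 1) * (y / 2 - 1))
    ((x - (x + 1) / 2) * (x - (x + 1) / 2) + (y - (y / 2 - 1)) * (y - (y / 2 - 1)))

/-- Boolean test that the reduced pair `u, v` satisfies the hypotheses of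
`ReducedBasis.not_covers_of_hole` for some `z` near the circumcenter. -/
def holeTest (u₁ u₂ v₁ v₂ a b D K : ℤ) : Bool :=
  decide (K * a < D * D) && decide (K * b < D * D) &&
    anyIcc (-1) 2 fun k => anyIcc (-1) 2 fun l =>
      (fun z₁ z₂ : ℤ =>
        (fun α β : ℤ => decide (0 ≤ α) && decide (α ≤ D * D) && decide (0 ≤ β) && decide (β ≤ D * D))
          (D * (z₁ * v₂ - z₂ * v₁)) (D * (u₁ * z₂ - u₂ * z₁)) &&
        decide (K < z₁ * z₁ + z₂ * z₂) &&
        decide (K < (z₁ - u₁) * (z₁ - u₁) + (z₂ - u₂) * (z₂ - u₂)) &&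
        decide (K < (z₁ - v₁) * (z₁ - v₁) + (z₂ - v₂) * (z₂ - v₂)) &&
        decide (K < (z₁ - u₁ - v₁) * (z₁ - u₁ - v₁) + (z₂ - u₂ - v₂) * (z₂ - u₂ - v₂)))
      ((a * v₂ - b * u₂) / (2 * D) + k) ((b * u₁ - a * v₁) / (2 * D) + l)

/-- Boolean test that `u, v` generate a signed permutation of `hnfLattice d.A d.b d.m`. -/
def congruentTest (u₁ u₂ v₁ v₂ D : ℤ) (d : LatticeDatum) : Bool :=
  decide (0 < d.A) && (D == d.A * d.m || D == -(d.A * d.m)) &&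
    [(1 : ℤˣ), -1].any fun e => [(1 : ℤˣ), -1].any fun f =>
      hnfMem d.A d.b d.m (e * u₁) (f * u₂) && hnfMem d.A d.b d.m (e * v₁) (f * v₂) ||
      hnfMem d.A d.b d.m (e * u₂) (f * u₁) && hnfMem d.A d.b d.m (e * v₂) (f * v₁)

/-- Boolean test that `X ≤ D ^ 2 * (4 * K + 4 * m + 2)` is possible with `m ^ 2 ≤ 2 * K`, where `X`
is the integer form of the squared circumradius. -/
def circumradiusTest (a b t D K : ℤ) : Bool :=
  evalAt (D * D) fun E => evalAt (a * b * (a + b - 2 * t) - E * (4 * K + 2)) fun Y =>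
    decide (Y ≤ 0) || decide (Y * Y ≤ 32 * E * E * K)

/-- Boolean test that a reduced pair `u, v` generates a lattice that is listed or violates a
necessary condition for quasi-perfection, where `k` bounds the squared covering radius. -/
def pairTest (k u₁ u₂ v₁ v₂ : ℤ) : Bool :=
  evalAt (u₁ * u₁ + u₂ * u₂) fun a => evalAt (v₁ * v₁ + v₂ * v₂) fun b =>
    decide (b < a) ||
    evalAt (u₁ * v₁ + u₂ * v₂) fun t => evalAt (u₁ * v₂ - u₂ * v₁) fun D => D == 0 ||
    !circumradiusTest a b t D k ||
    evalAt (min k (min (splitNorm v₁ v₂) (splitNorm (u₁ - v₁) (u₂ - v₂)))) fun K =>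
      decide (K < 2) || !circumradiusTest a b t D K || holeTest u₁ u₂ v₁ v₂ a b D K ||
      quasiPerfectData.any (congruentTest u₁ u₂ v₁ v₂ D) ||
      perfectData.any (congruentTest u₁ u₂ v₁ v₂ D)

theorem pairTest_eq_true : (allIcc 1 15 fun u₁ => allIcc 0 u₁ fun u₂ =>
    evalAt (min (shiftedSplitNorm u₁ u₂) (splitNorm u₁ u₂)) fun k => allIcc (-17) 17 fun v₂ =>
    allIcc (-(v₂ * u₂ / u₁)) (((u₁ * u₁ + u₂ * u₂) / 2 - v₂ * u₂) / u₁) fun v₁ =>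
      pairTest k u₁ u₂ v₁ v₂) = true := by
  decide +kernel

/-- The argument for `splitNorm` applies to any splitting. For odd `x`, large compared with `y > 1`,
the point with the larger first coordinate dominates, so shortening its second coordinate sharpens
the bound. -/
theorem QuasiPerfectAt.le_shiftedSplitNorm {M : ℤ → ℤ → Prop} {s t : ℤ}
    (h : QuasiPerfectAt M s t) {x y : ℤ} (hM : M x y) (h0 : x ≠ 0 ∨ y ≠ 0) :
    t ≤ shiftedSplitNorm x y := by
  by_contra! hlt
  have hsum : SumSq (shiftedSplitNorm x y) := by
    unfold shiftedSplitNorm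
    rcases max_choice (((x + 1) / 2) * ((x + 1) / 2) + (y / 2 - 1) * (y / 2 - 1))
      ((x - (x + 1) / 2) * (x - (x + 1) / 2) + (y - (y / 2 - 1)) * (y - (y / 2 - 1))) with h | h <;>
      rw [h]
    · exact ⟨_, _, congrArg₂ (· + ·) (sq _) (sq _)⟩
    · exact ⟨_, _, congrArg₂ (· + ·) (sq _) (sq _)⟩
  have hle : shiftedSplitNorm x y ≤ s := by
    by_contra! hs
    exact absurd (h.gap _ hsum hs) (not_le.2 hlt)
  have := h.packs ((x + 1) / 2) (y / 2 - 1) (-(x - (x + 1) / 2)) (-(y - (y / 2 - 1)))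
    (by rw [sq, sq]; exact (le_max_left _ _).trans hle)
    (by rw [neg_sq, neg_sq, sq, sq]; exact (le_max_right _ _).trans hle)
    (by simpa using hM)
  omega

/-! ### Soundness of the search -/

namespace ReducedBasis

variable {M : ℤ → ℤ → Prop} {u₁ u₂ v₁ v₂ : ℤ}

theorem mem_left (h : ReducedBasis M u₁ u₂ v₁ v₂) : M u₁ u₂ :=
  (h.mem_iff _ _).2 ⟨1, 0, by ring, by ring⟩

theorem mem_right (h : ReducedBasis M u₁ u₂ v₁ v₂) : M v₁ v₂ :=
  (h.mem_iff _ _).2 ⟨0, 1, by ring, by ring⟩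

theorem mem_sub (h : ReducedBasis M u₁ u₂ v₁ v₂) : M (u₁ - v₁) (u₂ - v₂) :=
  (h.mem_iff _ _).2 ⟨1, -1, by ring, by ring⟩

theorem left_ne_zero (h : ReducedBasis M u₁ u₂ v₁ v₂) : u₁ ≠ 0 ∨ u₂ ≠ 0 := by
  by_contra! h0
  exact h.det_ne_zero (by rw [h0.1, h0.2]; ring)

theorem right_ne_zero (h : ReducedBasis M u₁ u₂ v₁ v₂) : v₁ ≠ 0 ∨ v₂ ≠ 0 := by
  by_contra! h0
  exact h.det_ne_zero (by rw [h0.1, h0.2]; ring)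

theorem sub_ne_zero (h : ReducedBasis M u₁ u₂ v₁ v₂) : u₁ - v₁ ≠ 0 ∨ u₂ - v₂ ≠ 0 := by
  by_contra! h0
  refine h.det_ne_zero ?_
  rw [sub_eq_zero.1 h0.1, sub_eq_zero.1 h0.2]
  ring

theorem mem_of_dvd (h : ReducedBasis M u₁ u₂ v₁ v₂) {x y : ℤ}
    (h1 : u₁ * v₂ - u₂ * v₁ ∣ x * v₂ - y * v₁) (h2 : u₁ * v₂ - u₂ * v₁ ∣ u₁ * y - u₂ * x) :
    M x y := by
  obtain ⟨i, hi⟩ := h1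
  obtain ⟨j, hj⟩ := h2
  refine (h.mem_iff _ _).2 ⟨i, j, mul_left_cancel₀ h.det_ne_zero ?_,
    mul_left_cancel₀ h.det_ne_zero ?_⟩
  · linear_combination u₁ * hi + v₁ * hj
  · linear_combination u₂ * hi + v₂ * hj

end ReducedBasis

theorem hnfLattice_smul {A b m x y : ℤ} (k : ℤ) (h : hnfLattice A b m x y) :
    hnfLattice A b m (k * x) (k * y) := by
  obtain ⟨i, j, rfl, rfl⟩ := h
  exact ⟨k * i, k * j, by ring, by ring⟩

theorem dvd_det_of_hnfLattice {A b m x y x' y' : ℤ} (h : hnfLattice A b m x y)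
    (h' : hnfLattice A b m x' y') : A * m ∣ x * y' - y * x' := by
  obtain ⟨i, j, rfl, rfl⟩ := h
  obtain ⟨k, l, rfl, rfl⟩ := h'
  exact ⟨i * l - j * k, by ring⟩

theorem Int.units_mul_dvd_of_dvd (e f : ℤˣ) {k x y : ℤ} (h : k ∣ x)
    (hxy : x = e * f * y) : k ∣ y := by
  obtain ⟨c, rfl⟩ := h
  refine ⟨e * f * c, ?_⟩
  linear_combination (-(e : ℤ) * f) * hxy - (e : ℤ) * e * y * Int.units_coe_mul_coe_self f -
    y * Int.units_coe_mul_coe_self e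

/-- The signed permutation carries `u` and `v` into the listed lattice, and the determinants agree
up to sign. An inclusion between lattices of equal index is an equality. -/
theorem ReducedBasis.signedCongruent_of_test {M : ℤ → ℤ → Prop} {u₁ u₂ v₁ v₂ : ℤ}
    (h : ReducedBasis M u₁ u₂ v₁ v₂) {d : LatticeDatum}
    (hd : congruentTest u₁ u₂ v₁ v₂ (u₁ * v₂ - u₂ * v₁) d = true) :
    SignedCongruent M (hnfLattice d.A d.b d.m) := by
  unfold congruentTest at hd
  rw [Bool.and_eq_true, Bool.and_eq_true, decide_eq_true_eq, Bool.or_eq_true, beq_iff_eq,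
    beq_iff_eq, List.any_eq_true] at hd
  obtain ⟨⟨hA, hdet⟩, e, -, hd⟩ := hd
  obtain ⟨f, -, hd⟩ := List.any_eq_true.1 hd
  simp only [Bool.or_eq_true, Bool.and_eq_true, hnfMem_eq_true_iff hA] at hd
  have hdvd : ∀ z, d.A * d.m ∣ z → u₁ * v₂ - u₂ * v₁ ∣ z := by
    intro z hz
    rcases hdet with h | h <;> rw [h]
    · exact hz
    · exact (neg_dvd).2 hz
  rcases hd with ⟨hu, hv⟩ | ⟨hu, hv⟩
  · refine ⟨e, f, false, fun x y => ⟨fun hM => ?_, fun hH => ?_⟩⟩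
    · obtain ⟨i, j, rfl, rfl⟩ := (h.mem_iff _ _).1 hM
      have := hnfLattice_add (hnfLattice_smul i hu) (hnfLattice_smul j hv)
      simp only [signedPerm, Bool.false_eq_true, if_false]
      convert this using 1 <;> ring
    · simp only [signedPerm, Bool.false_eq_true, if_false] at hH
      exact h.mem_of_dvd
        (hdvd _ (Int.units_mul_dvd_of_dvd e f (dvd_det_of_hnfLattice hH hv) (by ring)))
        (hdvd _ (Int.units_mul_dvd_of_dvd e f (dvd_det_of_hnfLattice hu hH) (by ring)))
  · refine ⟨e, f, true, fun x y => ⟨fun hM => ?_, fun hH => ?_⟩⟩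
    · obtain ⟨i, j, rfl, rfl⟩ := (h.mem_iff _ _).1 hM
      have := hnfLattice_add (hnfLattice_smul i hu) (hnfLattice_smul j hv)
      simp only [signedPerm, if_true]
      convert this using 1 <;> ring
    · simp only [signedPerm, if_true] at hH
      exact h.mem_of_dvd
        (hdvd _ (Int.units_mul_dvd_of_dvd e f (dvd_det_of_hnfLattice hv hH) (by ring)))
        (hdvd _ (Int.units_mul_dvd_of_dvd e f (dvd_det_of_hnfLattice hH hu) (by ring)))

theorem ReducedBasis.not_covers_of_holeTest {M : ℤ → ℤ → Prop} {u₁ u₂ v₁ v₂ : ℤ}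
    (h : ReducedBasis M u₁ u₂ v₁ v₂) {K : ℤ}
    (ht : holeTest u₁ u₂ v₁ v₂ (u₁ ^ 2 + u₂ ^ 2) (v₁ ^ 2 + v₂ ^ 2) (u₁ * v₂ - u₂ * v₁) K = true) :
    ¬ Covers M K := by
  simp only [holeTest, Bool.and_eq_true, decide_eq_true_eq, anyIcc_eq_true_iff, ← pow_two] at ht
  obtain ⟨⟨hu, hv⟩, k, -, -, l, -, -, ⟨⟨⟨⟨⟨⟨h1, h2⟩, h3⟩, h4⟩, h5⟩, h6⟩, h7⟩, h8⟩ := ht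
  exact h.not_covers_of_hole rfl rfl rfl h1 h2 h3 h4 hu hv h5 h6 h7 h8

/-- The coordinates of a reduced basis are bounded if the lattice is covered at the radius at which
its shortest vector already prevents packing. -/
theorem ReducedBasis.bounds {M : ℤ → ℤ → Prop} {u₁ u₂ v₁ v₂ : ℤ}
    (h : ReducedBasis M u₁ u₂ v₁ v₂) (hu₂ : 0 ≤ u₂) (hu : u₂ ≤ u₁)
    (hcov : Covers M (splitNorm u₁ u₂)) : u₁ ≤ 15 ∧ -17 ≤ v₂ ∧ v₂ ≤ 17 := by
  obtain ⟨m, hm0, hm, hX⟩ := h.circumradius_le hcov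
  have hK := four_mul_splitNorm_le hu₂ hu
  obtain ⟨-, hdet, hdot, h2dot, hle⟩ := h
  set K := splitNorm u₁ u₂
  have hD : (u₁ * v₂ - u₂ * v₁) ^ 2 = (u₁ ^ 2 + u₂ ^ 2) * (v₁ ^ 2 + v₂ ^ 2) -
      (u₁ * v₁ + u₂ * v₂) ^ 2 := by ring
  have hDpos : 0 < (u₁ * v₂ - u₂ * v₁) ^ 2 := by positivity
  have ha0 : 0 ≤ u₁ ^ 2 + u₂ ^ 2 := by positivity
  have hb0 := ha0.trans hle
  have hua : u₁ ^ 2 ≤ u₁ ^ 2 + u₂ ^ 2 := by linarith [sq_nonneg u₂]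
  have hvb : v₂ ^ 2 ≤ v₁ ^ 2 + v₂ ^ 2 := by linarith [sq_nonneg v₁]
  generalize u₁ ^ 2 + u₂ ^ 2 = a at *
  generalize v₁ ^ 2 + v₂ ^ 2 = b at *
  generalize u₁ * v₁ + u₂ * v₂ = t at *
  generalize (u₁ * v₂ - u₂ * v₁) ^ 2 = E at *
  -- A side of a triangle is at most the diameter of its circumcircle.
  have hb : b ≤ 4 * K + 4 * m + 2 := by
    have h1 : E * b ≤ a * b * (a + b - 2 * t) := by
      have : a * b * (a + b - 2 * t) - E * b = b * (a - t) ^ 2 := by rw [hD]; ring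
      have := mul_nonneg hb0 (sq_nonneg (a - t))
      linarith
    exact le_of_mul_le_mul_left (h1.trans hX) hDpos
  -- The shortest side satisfies `a ≤ 3 R²`, with `R` the circumradius and equality for equilateral
  -- triangles.
  have ha : 4 * a ≤ 3 * (4 * K + 4 * m + 2) := by
    have h1 : E * (4 * a) ≤ 3 * (a * b * (a + b - 2 * t)) := by
      have h2 : 3 * (a * b * (a + b - 2 * t)) - E * (4 * a) =
          a * ((3 * b - a) * (b - a) + (a - 2 * t) * (3 * b - a - 2 * t)) := by rw [hD]; ring
      have h3 : 0 ≤ (3 * b - a) * (b - a) := mul_nonneg (by linarith) (by linarith)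
      have h4 : 0 ≤ (a - 2 * t) * (3 * b - a - 2 * t) := mul_nonneg (by linarith) (by linarith)
      have := mul_nonneg ha0 (add_nonneg h3 h4)
      linarith
    exact le_of_mul_le_mul_left (h1.trans (by linarith)) hDpos
  -- Together with the bound on `4 * K`, this gives `a ≤ 6 * u₁ + 12 * m + 12`. Since `m ^ 2 ≤ 2 *
  -- K`, `m` grows only like the square root of `u₁`, which is impossible from `u₁ = 16` on.
  have hu15 : u₁ ≤ 15 := by
    by_contra! h16
    have h1 : 7 * u₁ ≤ 12 * (m - 3) := by nlinarith
    have h2 : (m - 3) ^ 2 ≤ 4 * u₁ + 16 := by nlinarith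
    nlinarith
  have hm11 : m ≤ 11 := by nlinarith
  -- With `u₁ ≤ 15` and `m ≤ 11` the bounds give `a ≤ 234`, `4 * K ≤ 266` and `b ≤ 312`.
  have hb324 : v₂ ^ 2 < 18 ^ 2 := by linarith
  have h3 := abs_lt.1 (sq_lt_sq.1 hb324)
  norm_num at h3
  exact ⟨hu15, by linarith [h3.1], by linarith [h3.2]⟩

theorem ReducedBasis.circumradiusTest_eq_true {M : ℤ → ℤ → Prop} {u₁ u₂ v₁ v₂ : ℤ}
    (h : ReducedBasis M u₁ u₂ v₁ v₂) {K : ℤ} (hK : Covers M K) :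
    circumradiusTest (u₁ ^ 2 + u₂ ^ 2) (v₁ ^ 2 + v₂ ^ 2) (u₁ * v₁ + u₂ * v₂)
      (u₁ * v₂ - u₂ * v₁) K = true := by
  obtain ⟨m, hm0, hm, hX⟩ := h.circumradius_le hK
  simp only [circumradiusTest, evalAt_eq, ← pow_two, Bool.or_eq_true, decide_eq_true_eq]
  have hDpos : 0 < (u₁ * v₂ - u₂ * v₁) ^ 2 := by
    have := h.det_ne_zero
    positivity
  generalize (u₁ * v₂ - u₂ * v₁) ^ 2 = E at *
  set X := (u₁ ^ 2 + u₂ ^ 2) * (v₁ ^ 2 + v₂ ^ 2) *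
      (u₁ ^ 2 + u₂ ^ 2 + (v₁ ^ 2 + v₂ ^ 2) - 2 * (u₁ * v₁ + u₂ * v₂))
  rcases le_or_gt (X - E * (4 * K + 2)) 0 with h1 | h1
  · exact .inl h1
  · right
    have h3 : X - E * (4 * K + 2) ≤ 4 * E * m := by linarith
    have h4 : (X - E * (4 * K + 2)) ^ 2 ≤ (4 * E * m) ^ 2 := pow_le_pow_left₀ h1.le h3 2
    have h5 := mul_le_mul_of_nonneg_left hm (by positivity : (0 : ℤ) ≤ 16 * E ^ 2)
    linarith

theorem ReducedBasis.exists_signedCongruent {M : ℤ → ℤ → Prop} {u₁ u₂ v₁ v₂ : ℤ}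
    (h : ReducedBasis M u₁ u₂ v₁ v₂) (hu₂ : 0 ≤ u₂) (hu : u₂ ≤ u₁) {s t : ℤ}
    (hM : QuasiPerfectAt M s t) :
    ∃ d ∈ quasiPerfectData, SignedCongruent M (hnfLattice d.A d.b d.m) := by
  have ht1 := hM.le_splitNorm h.mem_left h.left_ne_zero
  have ht2 := hM.le_splitNorm h.mem_right h.right_ne_zero
  have ht3 := hM.le_splitNorm h.mem_sub h.sub_ne_zero
  have ht4 := hM.le_shiftedSplitNorm h.mem_left h.left_ne_zero
  obtain ⟨hu15, hv17, hv17'⟩ := h.bounds hu₂ hu (hM.covers.mono ht1)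
  have hu1 : 1 ≤ u₁ := by
    have := h.left_ne_zero
    omega
  have htest := pairTest_eq_true
  simp only [allIcc_eq_true_iff, evalAt_eq] at htest
  -- The range for `v₁` is `0 ≤ 2 * (u · v) ≤ |u|²` solved for `v₁`, using `u₁ > 0`.
  have htest := htest u₁ hu1 hu15 u₂ hu₂ hu v₂ hv17 hv17' v₁ (by
      have : -v₁ ≤ v₂ * u₂ / u₁ := by
        rw [Int.le_ediv_iff_mul_le (by linarith)]
        linarith [h.dot_nonneg]
      linarith) (by
      rw [Int.le_ediv_iff_mul_le (by linarith)]
      have h1 : u₁ * v₁ + u₂ * v₂ ≤ (u₁ * u₁ + u₂ * u₂) / 2 := by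
        rw [Int.le_ediv_iff_mul_le (by norm_num)]
        linarith [h.two_dot_le]
      linarith)
  have hk : t ≤ min (shiftedSplitNorm u₁ u₂) (splitNorm u₁ u₂) := le_min ht4 ht1
  simp only [pairTest, evalAt_eq] at htest
  generalize min (shiftedSplitNorm u₁ u₂) (splitNorm u₁ u₂) = k at *
  have hK : t ≤ min k (min (splitNorm v₁ v₂) (splitNorm (u₁ - v₁) (u₂ - v₂))) :=
    le_min hk (le_min ht2 ht3)
  generalize min k (min (splitNorm v₁ v₂) (splitNorm (u₁ - v₁) (u₂ - v₂))) = K at *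
  have hcov := hM.covers.mono hK
  have hcirc := h.circumradiusTest_eq_true (hM.covers.mono hk)
  have hcirc' := h.circumradiusTest_eq_true hcov
  simp only [← pow_two] at htest
  simp only [hcirc, hcirc', Bool.not_true, Bool.or_false, Bool.or_eq_true, decide_eq_true_eq,
    beq_iff_eq, List.any_eq_true] at htest
  rcases htest with h1 | h1 | ((h1 | h1) | h1) | h1
  · exact absurd h.norm_le (not_le.2 h1)
  · exact absurd h1 h.det_ne_zero
  · have := hM.one_le
    have := hM.lt
    omega
  · exact absurd hcov (h.not_covers_of_holeTest h1)
  · obtain ⟨d, hd, h1⟩ := h1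
    exact ⟨d, hd, h.signedCongruent_of_test h1⟩
  · exfalso
    obtain ⟨d, hd, h1⟩ := h1
    exact perfectData_not_quasiPerfectAt d hd s t
      ((h.signedCongruent_of_test h1).symm.quasiPerfectAt hM)

/-! ### The classification and the set of radii -/

theorem signedCongruent_latticeOf_iff (L : AddSubgroup (Fin 2 → ℤ)) (A b m : ℤ) :
    SignedCongruent (memPred L) (hnfLattice A b m) ↔
      LatticeCongruent L (latticeOf !![A, b; 0, m]) := by
  rw [latticeCongruent_iff]
  have : memPred (latticeOf !![A, b; 0, m]) = hnfLattice A b m := by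
    ext x y
    exact memPred_latticeOf A b m x y
  rw [this]

theorem exists_signedCongruent_of_quasiPerfectAt {L : AddSubgroup (Fin 2 → ℤ)}
    (hL : IsLinearCode L) {s t : ℤ} (h : QuasiPerfectAt (memPred L) s t) :
    ∃ d ∈ quasiPerfectData, SignedCongruent (memPred L) (hnfLattice d.A d.b d.m) := by
  obtain ⟨u₁, u₂, v₁, v₂, hB⟩ := exists_reducedBasis_memPred L ((isLinearCode_iff L).1 hL)
  obtain ⟨N, a, b, c, e, hN, hB', hb, hba⟩ := hB.exists_octant
  obtain ⟨d, hd, hc⟩ := hB'.exists_signedCongruent hb hba (hN.quasiPerfectAt h)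
  exact ⟨d, hd, hN.symm.trans hc⟩

theorem isLinearCode_of_signedCongruent {L : AddSubgroup (Fin 2 → ℤ)} {d : LatticeDatum}
    (hd : d ∈ quasiPerfectData) (h : SignedCongruent (memPred L) (hnfLattice d.A d.b d.m)) :
    IsLinearCode L := by
  have htest := (List.all_eq_true.1 quasiPerfectData_test) d hd
  simp only [quasiPerfectTest, Bool.and_eq_true, decide_eq_true_eq] at htest
  obtain ⟨⟨⟨⟨⟨⟨⟨⟨⟨⟨hA, hm⟩, -⟩, -⟩, -⟩, -⟩, -⟩, -⟩, -⟩, -⟩, -⟩ := htest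
  refine (isLinearCode_iff L).2 (h.hasRankTwo ⟨d.A, d.b, 0, d.m, ⟨1, 0, by ring, by ring⟩,
    ⟨0, 1, by ring, by ring⟩, ?_⟩)
  rw [mul_zero, sub_zero]
  exact mul_ne_zero hA.ne' hm.ne'

theorem radii_eq_image : ({1, 2, 3, 4, √2, √5, 2 * √5, √10} : Set ℝ) =
    (fun s : ℤ => √(s : ℝ)) '' {1, 4, 9, 16, 2, 5, 20, 10} := by
  have h2 : √(4 : ℝ) = 2 := by
    rw [show (4 : ℝ) = 2 ^ 2 by norm_num, Real.sqrt_sq (by norm_num)]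
  have h3 : √(9 : ℝ) = 3 := by
    rw [show (9 : ℝ) = 3 ^ 2 by norm_num, Real.sqrt_sq (by norm_num)]
  have h4 : √(16 : ℝ) = 4 := by
    rw [show (16 : ℝ) = 4 ^ 2 by norm_num, Real.sqrt_sq (by norm_num)]
  have h5 : √(20 : ℝ) = 2 * √5 := by
    rw [show (20 : ℝ) = 2 ^ 2 * 5 by norm_num, Real.sqrt_mul (by norm_num),
      Real.sqrt_sq (by norm_num)]
  simp only [Set.image_insert_eq, Set.image_singleton, Int.cast_ofNat, Int.cast_one, Real.sqrt_one,
    h2, h3, h4, h5]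

theorem datum_radius_mem (d : LatticeDatum) (hd : d ∈ quasiPerfectData) :
    d.s ∈ ({1, 4, 9, 16, 2, 5, 20, 10} : Set ℤ) := by
  have h := quasiPerfectData_radius d hd
  simp only [List.mem_cons, Prod.mk.injEq, List.not_mem_nil, or_false] at h
  simp only [Set.mem_insert_iff, Set.mem_singleton_iff]
  omega

theorem exists_datum_of_radius (s : ℤ) (hs : s ∈ ({1, 4, 9, 16, 2, 5, 20, 10} : Set ℤ)) :
    ∃ d ∈ quasiPerfectData, d.s = s := by
  simp only [Set.mem_insert_iff, Set.mem_singleton_iff] at hs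
  rcases hs with rfl | rfl | rfl | rfl | rfl | rfl | rfl | rfl <;> decide +kernel

theorem proposition22 :
    (∀ L : AddSubgroup (Fin 2 → ℤ),
      (IsLinearCode L ∧ IsQuasiPerfect (L : Set (Fin 2 → ℤ)) ∧
          ∃ r : ℝ, 0 < r ∧ IsPackingRadius (L : Set (Fin 2 → ℤ)) r) ↔
        ∃ B ∈ generatorsA ∪ generatorsExtra, LatticeCongruent L (latticeOf B)) ∧
    {r : ℝ | 0 < r ∧ ∃ L : AddSubgroup (Fin 2 → ℤ),
        IsLinearCode L ∧ IsQuasiPerfect (L : Set (Fin 2 → ℤ)) ∧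
          IsPackingRadius (L : Set (Fin 2 → ℤ)) r} =
      {1, 2, 3, 4, Real.sqrt 2, Real.sqrt 5, 2 * Real.sqrt 5, Real.sqrt 10} := by
  have hconv : ∀ (L : AddSubgroup (Fin 2 → ℤ)) (d : LatticeDatum), d ∈ quasiPerfectData →
      SignedCongruent (memPred L) (hnfLattice d.A d.b d.m) →
        IsLinearCode L ∧ QuasiPerfectAt (memPred L) d.s d.t := fun L d hd h =>
    ⟨isLinearCode_of_signedCongruent hd h,
      h.quasiPerfectAt (quasiPerfectData_quasiPerfectAt d hd)⟩
  constructor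
  · intro L
    constructor
    · rintro ⟨hL, hQ, r, hr, hp⟩
      obtain ⟨s, t, -, h⟩ := quasiPerfectAt_of_isQuasiPerfect hQ hr hp
      obtain ⟨d, hd, hc⟩ := exists_signedCongruent_of_quasiPerfectAt hL h
      exact ⟨_, mem_generators_of_datum d hd, (signedCongruent_latticeOf_iff L _ _ _).1 hc⟩
    · rintro ⟨B, hB, hc⟩
      obtain ⟨d, hd, rfl⟩ := exists_datum_of_mem_generators B hB
      obtain ⟨h1, h2⟩ := hconv L d hd ((signedCongruent_latticeOf_iff L _ _ _).2 hc)
      exact ⟨h1, h2.isQuasiPerfect, _, h2.sqrt_pos, h2.isPackingRadius⟩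
  · rw [radii_eq_image]
    ext r
    constructor
    · rintro ⟨hr, L, hL, hQ, hp⟩
      obtain ⟨s, t, rfl, h⟩ := quasiPerfectAt_of_isQuasiPerfect hQ hr hp
      obtain ⟨d, hd, hc⟩ := exists_signedCongruent_of_quasiPerfectAt hL h
      exact ⟨d.s, datum_radius_mem d hd, (hconv L d hd hc).2.isPackingRadius.unique hp⟩
    · rintro ⟨s, hs, rfl⟩
      obtain ⟨d, hd, rfl⟩ := exists_datum_of_radius s hs
      obtain ⟨h1, h2⟩ := hconv (latticeOf !![d.A, d.b; 0, d.m]) d hd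
        ⟨1, 1, false, fun x y => by simp [signedPerm, memPred_latticeOf]⟩
      exact ⟨h2.sqrt_pos, _, h1, h2.isQuasiPerfect, h2.isPackingRadius⟩
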